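/- Let $\hat f,Q,\omega\in C^0([0,1],[0,\infty))$ with $\hat f(1)=1$ and $\hat f^{-1}(0)=Q^{-1}(0)=\omega^{-1}(0)=\{0\}$. Assume that $Q$ and $t\mapsto(\hat f(t)/Q(1-t))^{1/2}$ are non-decreasing in a right neighbourhood of $0$, that $\lim_{t\to0^+}(\omega(t)/Q(t))^{1/2}$ exists in $[0,\infty]$, and that $$\hat k(t):=\frac{\omega(1-t)}{Q(1-t)}\hat f(t)$$ is strictly increasing on $[0,1)$. Let $m\in(0,1)$ and $s\in(0,\infty)$, and let $\hat k_m(t):=\hat k(m+|t-m|)$ and $\omega_m(1-t):=\omega(1-m-|t-m|)$ for $t\in(2m-1,1)$. Let $\zeta_{m,s}$ be the affine function with $\zeta_{m,s}(2m-1)=0$, $\zeta_{m,s}(1)=s$. Define $G_{m,s}:L^1((2m-1,1))\to[0,\infty]$ by $$G_{m,s}(w)=\int_{2m-1}^1\big(\hat k_m(t)|w'|^2+\omega_m(1-t)\big)^{1/2}dt\quad\text{if }w\in\zeta_{m,s}+W^{1,1}_0((2m-1,1)),$$ and $G_{m,s}(w)=\infty$ otherwise, and let $sc^-G_{m,s}$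 be its lower semicontinuous envelope in the $L^1$ topology. For $\lambda\in(0,\hat k^{1/2}(m)]$ put $$A(m,\lambda)=2\int_m^1\Big(\frac{\hat k(t)-\lambda^2}{\hat k(t)}\omega(1-t)\Big)^{1/2}dt,\qquad B(m,\lambda)=2\int_m^1\Big(\frac{\lambda^2\omega(1-t)}{\hat k(t)(\hat k(t)-\lambda^2)}\Big)^{1/2}dt\in[0,\infty],$$ and $\mathscr G(m,\lambda)=A(m,\lambda)+\lambda B(m,\lambda)$. Then $sc^-G_{m,s}$ has a unique minimizer $w_{m,s}$ on $L^1((2m-1,1))$, and its minimal value $\mathfrak G_s(m):=sc^-G_{m,s}(w_{m,s})$ is finite. Moreover $w_{m,s}\in SBV((2m-1,1))$; it has a representative which is strictly increasing, odd symmetric about $m$ (that is, $w_{m,s}(2m-t)-\frac s2=-(w_{m,s}(t)-\frac s2)$), and attains continuously the values $w_{m,s}(2m-1)=0$, $w_{m,s}(1)=s$; the singular part of $Dw_{m,s}$ is concentrated on $\{m\}$; and there is a unique $\lambda_{m,s}\in(0,\hat k^{1/2}(m)]$ such that the density $w_{m,s}'$ of the absolutely continuous part of $Dw_{m,s}$ satisfies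 $$w_{m,s}'(t)=\Big(\frac{\lambda_{m,s}^2\,\omega_m(1-t)}{\hat k_m(t)(\hat k_m(t)-\lambda_{m,s}^2)}\Big)^{1/2}\quad\text{for a.e. }t\in(2m-1,1).$$ Furthermore $w_{m,s}(m^+)\ge\frac s2$ and $$\mathfrak G_s(m)=2\int_m^1\big(\hat k(t)|w_{m,s}'|^2+\omega(1-t)\big)^{1/2}dt+2\hat k^{1/2}(m)\big(w_{m,s}(m^+)-\tfrac s2\big),$$ and exactly one of the following two cases occurs. (1) $w_{m,s}\in W^{1,1}((2m-1,1))$. This holds if and only if $s=B(m,\lambda_{m,s})$. In this case $w_{m,s}$ is continuous with $w_{m,s}(m)=\frac s2$, and $$\mathfrak G_s(m)=2\int_m^1\Big(\frac{\hat k(t)\omega(1-t)}{\hat k(t)-\lambda_{m,s}^2}\Big)^{1/2}dt=\mathscr G(m,\lambda_{m,s})=A(m,\lambda_{m,s})+\lambda_{m,s}s.$$ (2) $w_{m,s}\in SBV\setminus W^{1,1}((2m-1,1))$. This holds if and only if $s>B(m,\hat k^{1/2}(m))$. In this case $\lambda_{m,s}=\hat k^{1/2}(m)$, the only jump of $w_{m,s}$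 is at $t=m$, $w_{m,s}(m^+)=s-\frac12B(m,\hat k^{1/2}(m))$, and $$\mathfrak G_s(m)=2\int_m^1\Big(\frac{\hat k(t)\omega(1-t)}{\hat k(t)-\hat k(m)}\Big)^{1/2}dt+\hat k^{1/2}(m)\big(s-B(m,\hat k^{1/2}(m))\big)$$ $$=\mathscr G(m,\hat k^{1/2}(m))+\hat k^{1/2}(m)\big(s-B(m,\hat k^{1/2}(m))\big)=A(m,\hat k^{1/2}(m))+\hat k^{1/2}(m)\,s.$$ -/

import Mathlib

open MeasureTheory Set Filter Topology
open scoped ENNReal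

namespace CohesivePhaseField

noncomputable section

/-! ### The data -/

/-- The function `k̂(t) = ω(1-t) / Q(1-t) * f̂(t)`, used for `t ∈ [0,1)`. -/
def kHat (f Q ω : ℝ → ℝ) (t : ℝ) : ℝ := ω (1 - t) / Q (1 - t) * f t

/-- The standing assumptions on `f̂`, `Q` and the damage potential `ω`; only the values on `[0,1]`
matter. -/
structure Hypotheses (f Q ω : ℝ → ℝ) : Prop where
  f_cont : ContinuousOn f (Icc 0 1)
  f_nonneg : ∀ t ∈ Icc (0 : ℝ) 1, 0 ≤ f t
  f_one : f 1 = 1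
  f_zero : ∀ t ∈ Icc (0 : ℝ) 1, f t = 0 ↔ t = 0
  Q_cont : ContinuousOn Q (Icc 0 1)
  Q_nonneg : ∀ t ∈ Icc (0 : ℝ) 1, 0 ≤ Q t
  Q_zero : ∀ t ∈ Icc (0 : ℝ) 1, Q t = 0 ↔ t = 0
  Q_mono : ∃ δ ∈ Ioo (0 : ℝ) 1, MonotoneOn Q (Icc 0 δ)
  deg_mono : ∃ δ ∈ Ioo (0 : ℝ) 1, MonotoneOn (fun t => √(f t / Q (1 - t))) (Icc 0 δ)
  ω_cont : ContinuousOn ω (Icc 0 1)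
  ω_nonneg : ∀ t ∈ Icc (0 : ℝ) 1, 0 ≤ ω t
  ω_zero : ∀ t ∈ Icc (0 : ℝ) 1, ω t = 0 ↔ t = 0
  ω_lim : ∃ σ : ℝ≥0∞, Tendsto (fun t => ENNReal.ofReal √(ω t / Q t)) (𝓝[>] 0) (𝓝 σ)
  k_strictMono : StrictMonoOn (kHat f Q ω) (Ico 0 1)

/-- `k̂_m`: the even extension with respect to `t = m` of `k̂` restricted to `[m,1)`. -/
def kEven (f Q ω : ℝ → ℝ) (m t : ℝ) : ℝ := kHat f Q ω (m + |t - m|)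

/-- `ω_m(1-·)`: the even extension with respect to `t = m` of `ω(1-·)` restricted to `[m,1]`. -/
def omegaEven (ω : ℝ → ℝ) (m t : ℝ) : ℝ := ω (1 - (m + |t - m|))

/-! ### Weak derivatives, `W^{1,1}`, `W^{1,1}_0` and `SBV` on an interval `(a,b)` -/

/-- `φ ∈ C_c^∞((a,b))`. -/
def IsTestFunction (a b : ℝ) (φ : ℝ → ℝ) : Prop :=
  ContDiff ℝ (⊤ : ℕ∞) φ ∧ HasCompactSupport φ ∧ tsupport φ ⊆ Ioo a b

/-- `w, g ∈ L^1((a,b))` and `g` is the weak derivative of `w`. -/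
def HasWeakDeriv (a b : ℝ) (w g : ℝ → ℝ) : Prop :=
  IntegrableOn w (Ioo a b) ∧ IntegrableOn g (Ioo a b) ∧
    ∀ φ, IsTestFunction a b φ →
      ∫ x in Ioo a b, w x * deriv φ x = -∫ x in Ioo a b, g x * φ x

/-- `w ∈ W^{1,1}((a,b))`. -/
def MemW11 (a b : ℝ) (w : ℝ → ℝ) : Prop := ∃ g, HasWeakDeriv a b w g

/-- `w ∈ W^{1,1}_0((a,b))`: `w ∈ W^{1,1}((a,b))` and its continuous representative vanishes at
`a` and `b`. -/
def MemW11Zero (a b : ℝ) (w : ℝ → ℝ) : Prop :=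
  MemW11 a b w ∧ ∃ v : ℝ → ℝ, ContinuousOn v (Icc a b) ∧
    v =ᵐ[volume.restrict (Ioo a b)] w ∧ v a = 0 ∧ v b = 0

/-- `w ∈ BV((a,b))`, and its distributional derivative is the finite measure
`Dw = g 𝓛¹ + ν` on `(a,b)`, where `g` is integrable and `ν = D^s w` is singular with respect to the
Lebesgue measure. Thus `g` is the density `w'` of the absolutely continuous part of `Dw`. The
integral of `φ` against `ν` is written with the positive and negative parts of `ν`. -/
def HasBVDeriv (a b : ℝ) (w g : ℝ → ℝ) (ν : SignedMeasure ℝ) : Prop :=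
  IntegrableOn w (Ioo a b) ∧ IntegrableOn g (Ioo a b) ∧
    ν.totalVariation (Ioo a b)ᶜ = 0 ∧ ν.totalVariation ⟂ₘ (volume : Measure ℝ) ∧
    ∀ φ, IsTestFunction a b φ →
      ∫ x in Ioo a b, w x * deriv φ x =
        -((∫ x in Ioo a b, g x * φ x) +
          ((∫ x, φ x ∂ν.toJordanDecomposition.posPart) -
            ∫ x, φ x ∂ν.toJordanDecomposition.negPart))

/-- `w ∈ SBV((a,b))`: `w ∈ BV((a,b))` and `Dw` has no Cantor part, that is, the singular part of
`Dw` is concentrated on a countable set. -/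
def MemSBV (a b : ℝ) (w : ℝ → ℝ) : Prop :=
  ∃ g ν, HasBVDeriv a b w g ν ∧ ∃ J : Set ℝ, J.Countable ∧ ν.totalVariation Jᶜ = 0

/-! ### The functionals -/

/-- The space `L^1((2m-1,1))` with its norm topology. -/
abbrev L1 (m : ℝ) : Type := Lp ℝ 1 (volume.restrict (Ioo (2 * m - 1) 1))

/-- The affine function `ζ_{m,s}` with `ζ_{m,s}(2m-1) = 0` and `ζ_{m,s}(1) = s`. -/
def zeta (m s t : ℝ) : ℝ := s * (t - (2 * m - 1)) / (2 * (1 - m))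

/-- `G_m(w) = ∫_{2m-1}^1 (k̂_m(t)|w'|² + ω_m(1-t))^{1/2} dt ∈ [0,∞]` for `w ∈ W^{1,1}((2m-1,1))`.
The infimum ranges over the weak derivatives of `w`, which all coincide almost everywhere. -/
def GFun (f Q ω : ℝ → ℝ) (m : ℝ) (w : ℝ → ℝ) : ℝ≥0∞ :=
  ⨅ (g : ℝ → ℝ) (_ : HasWeakDeriv (2 * m - 1) 1 w g),
    ∫⁻ t in Ioo (2 * m - 1) 1, ENNReal.ofReal √(kEven f Q ω m t * |g t| ^ 2 + omegaEven ω m t)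

open Classical in
/-- `G_{m,s}` on `L^1((2m-1,1))`: equal to `G_m` on `ζ_{m,s} + W^{1,1}_0((2m-1,1))`, and to `∞`
elsewhere. -/
def GFunDirichlet (f Q ω : ℝ → ℝ) (m s : ℝ) (w : L1 m) : ℝ≥0∞ :=
  if MemW11Zero (2 * m - 1) 1 (fun t => w t - zeta m s t) then GFun f Q ω m w else ⊤

/-- The lower semicontinuous envelope of `F`: the greatest lower semicontinuous function
below `F`. -/
def lscEnvelope {X : Type*} [TopologicalSpace X] (F : X → ℝ≥0∞) (x : X) : ℝ≥0∞ :=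
  ⨆ H : {H : X → ℝ≥0∞ // LowerSemicontinuous H ∧ ∀ y, H y ≤ F y}, H.1 x

/-- The relaxation `sc⁻G_{m,s}` of `G_{m,s}` in `L^1((2m-1,1))`. -/
def scG (f Q ω : ℝ → ℝ) (m s : ℝ) : L1 m → ℝ≥0∞ := lscEnvelope (GFunDirichlet f Q ω m s)

/-- `w` is a minimizer of `sc⁻G_{m,s}` on `L^1((2m-1,1))`. -/
def IsMinimizer (f Q ω : ℝ → ℝ) (m s : ℝ) (w : L1 m) : Prop :=
  scG f Q ω m s w = ⨅ v : L1 m, scG f Q ω m s v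

/-! ### The auxiliary functions `A`, `B` and `𝒢` -/

/-- `A(m,λ) = 2 ∫_m^1 ((k̂(t)-λ²)/k̂(t) ω(1-t))^{1/2} dt`. -/
def AFun (f Q ω : ℝ → ℝ) (m l : ℝ) : ℝ≥0∞ :=
  2 * ∫⁻ t in Ioo m 1,
    ENNReal.ofReal √((kHat f Q ω t - l ^ 2) / kHat f Q ω t * ω (1 - t))

/-- `B(m,λ) = 2 ∫_m^1 (λ² ω(1-t) / (k̂(t)(k̂(t)-λ²)))^{1/2} dt ∈ [0,∞]`. -/
def BFun (f Q ω : ℝ → ℝ) (m l : ℝ) : ℝ≥0∞ :=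
  2 * ∫⁻ t in Ioo m 1,
    ENNReal.ofReal √(l ^ 2 * ω (1 - t) / (kHat f Q ω t * (kHat f Q ω t - l ^ 2)))

/-- `𝒢(m,λ) = A(m,λ) + λ B(m,λ) ∈ [0,∞]`. -/
def scriptG (f Q ω : ℝ → ℝ) (m l : ℝ) : ℝ≥0∞ :=
  AFun f Q ω m l + ENNReal.ofReal l * BFun f Q ω m l

/-- The right-hand side `(λ² ω_m(1-t) / (k̂_m(t)(k̂_m(t)-λ²)))^{1/2}` of the Euler–Lagrange
formula. -/
def slope (f Q ω : ℝ → ℝ) (m l t : ℝ) : ℝ :=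
  √(l ^ 2 * omegaEven ω m t / (kEven f Q ω m t * (kEven f Q ω m t - l ^ 2)))

end

end CohesivePhaseField

/-! The proof is a calibration argument; it needs neither an integral representation of the relaxed
functional on `BV` nor a compactness theorem. Fix λ with 0 ≤ λ ≤ √k̂(m). Since k̂ is strictly
increasing, λ² < k̂_m(t) for every t ≠ m, and convexity of ξ ↦ √(k̂_m ξ² + ω_m) gives the affine
minorant λξ + √((k̂_m − λ²)/k̂_m · ω_m), touched exactly at ξ = `slope`. A competitor has derivative
of total integral s, so its energy is at least λs + A(m,λ). This bound is a constant, hence lower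
semicontinuous, and so it passes to `scG` (`ofReal_le_scG`).

The bound is attained for the right λ. B(m,·) increases from 0, so either B(m,λ) = s has a solution,
or B(m,√k̂(m)) ≤ s and λ = √k̂(m) is taken (`exists_multiplier`). The candidate is the odd primitive
of the slope with a jump J = s − B(m,λ) at m, where k̂_m is smallest and a jump is cheapest.
Replacing the jump by steep ramps shows that its relaxed energy is at most λB + A + √k̂(m)·J
(`scG_jumpPrimitive_le`). As J ≠ 0 only if λ = √k̂(m), this equals λs + A.

Uniqueness uses a quantitative form of convexity (`sqrt_mul_abs_sub_slope_le`): the excess energy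
controls the L¹ distance of the derivative to the slope away from m. After integration, this gives
continuous minorants of the functional that penalize |∫_S v − ∫_S w| for sets S away from m
(`ofReal_div_le_scG`), so a function of minimal relaxed energy must equal w (`eq_of_scG_le`). The
remaining formulas are identities between the energy of the slope, A and B. -/

namespace CohesivePhaseField

/-! ### Test functions, weak derivatives and primitives on an interval -/

variable {a b c m : ℝ} {w g φ ψ : ℝ → ℝ}

lemma IsTestFunction.eq_zero_of_notMem (hφ : IsTestFunction a b φ) {t : ℝ} (ht : t ∉ Ioo a b) :
    φ t = 0 :=
  image_eq_zero_of_notMem_tsupport fun h => ht (hφ.2.2 h)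

lemma IsTestFunction.continuous_deriv (hφ : IsTestFunction a b φ) : Continuous (deriv φ) :=
  hφ.1.continuous_deriv (by simp)

lemma IsTestFunction.integrableOn_mul (hφ : IsTestFunction a b φ) (hw : IntegrableOn w (Ioo a b)) :
    IntegrableOn (fun x => w x * φ x) (Ioo a b) := by
  obtain ⟨C, hC⟩ := hφ.2.1.exists_bound_of_continuous hφ.1.continuous
  exact hw.mul_bdd (c := C) hφ.1.continuous.aestronglyMeasurable (ae_of_all _ hC)

lemma IsTestFunction.integrableOn_mul_deriv (hφ : IsTestFunction a b φ)
    (hw : IntegrableOn w (Ioo a b)) : IntegrableOn (fun x => w x * deriv φ x) (Ioo a b) := by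
  obtain ⟨C, hC⟩ := hφ.2.1.deriv.exists_bound_of_continuous hφ.continuous_deriv
  exact hw.mul_bdd (c := C) hφ.continuous_deriv.aestronglyMeasurable (ae_of_all _ hC)

lemma intervalIntegral_eq_setIntegral_Ioo (hab : a ≤ b) (F : ℝ → ℝ) :
    ∫ x in a..b, F x = ∫ x in Ioo a b, F x := by
  rw [intervalIntegral.integral_of_le hab, integral_Ioc_eq_integral_Ioo]

lemma intervalIntegrable_of_integrableOn_Ioo (hg : IntegrableOn g (Ioo a b)) {x y : ℝ}
    (hx : x ∈ Icc a b) (hy : y ∈ Icc a b) : IntervalIntegrable g volume x y := by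
  have hg' : IntegrableOn g (Icc a b) := by rwa [integrableOn_Icc_iff_integrableOn_Ioo]
  exact (hg'.mono_set (uIcc_subset_Icc hx hy)).intervalIntegrable

lemma continuousOn_primitive (hg : IntegrableOn g (Ioo a b)) (hc : c ∈ Icc a b) :
    ContinuousOn (fun x => ∫ y in c..x, g y) (Icc a b) := by
  have hab : a ≤ b := hc.1.trans hc.2
  have hg' : IntegrableOn g (uIcc a b) := by
    rwa [uIcc_of_le hab, integrableOn_Icc_iff_integrableOn_Ioo]
  have := intervalIntegral.continuousOn_primitive_interval' (b₁ := a) (b₂ := b) (a := c)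
    (hg'.intervalIntegrable) (by rwa [uIcc_of_le hab])
  rwa [uIcc_of_le hab] at this

lemma integrableOn_primitive (hg : IntegrableOn g (Ioo a b)) (hc : c ∈ Icc a b) :
    IntegrableOn (fun x => ∫ y in c..x, g y) (Ioo a b) :=
  ((continuousOn_primitive hg hc).integrableOn_compact isCompact_Icc).mono_set Ioo_subset_Icc_self

/-- Integration by parts for the primitive of an integrable function. -/
lemma integral_primitive_mul_deriv (hg : IntegrableOn g (Ioo a b)) (hc : c ∈ Icc a b)
    (hφ : IsTestFunction a b φ) :
    ∫ x in Ioo a b, (∫ y in c..x, g y) * deriv φ x = -∫ x in Ioo a b, g x * φ x := by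
  have hab : a ≤ b := hc.1.trans hc.2
  have hgi : IntervalIntegrable g volume a b :=
    intervalIntegrable_of_integrableOn_Ioo hg (left_mem_Icc.2 hab) (right_mem_Icc.2 hab)
  have hc' : c ∈ uIcc a b := by rwa [uIcc_of_le hab]
  have h1 := (hgi.absolutelyContinuousOnInterval_intervalIntegral hc')
  have h2 : AbsolutelyContinuousOnInterval φ a b :=
    ((hφ.1.of_le (by simp)).contDiffOn).absolutelyContinuousOnInterval
  have := h1.integral_mul_deriv_eq_deriv_mul h2
  rw [hφ.eq_zero_of_notMem (t := a) (by simp), hφ.eq_zero_of_notMem (t := b) (by simp)] at this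
  rw [← intervalIntegral_eq_setIntegral_Ioo hab, ← intervalIntegral_eq_setIntegral_Ioo hab, this]
  simp only [mul_zero, sub_self, zero_sub, neg_inj]
  apply intervalIntegral.integral_congr_ae
  filter_upwards [hgi.ae_hasDerivAt_integral] with x hx hx'
  rw [(hx (uIoc_subset_uIcc hx') c hc').deriv]

lemma integral_deriv_eq_sub_of_isTestFunction (hφ : IsTestFunction a b φ) (x y : ℝ) :
    ∫ t in x..y, deriv φ t = φ y - φ x :=
  intervalIntegral.integral_deriv_eq_sub (fun _ _ => (hφ.1.differentiable (by simp)).differentiableAt)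
    (hφ.continuous_deriv.intervalIntegrable _ _)

lemma integral_const_mul_deriv (hab : a ≤ b) (C : ℝ) (hφ : IsTestFunction a b φ) :
    ∫ x in Ioo a b, C * deriv φ x = 0 := by
  rw [integral_const_mul, ← intervalIntegral_eq_setIntegral_Ioo hab,
    integral_deriv_eq_sub_of_isTestFunction hφ, hφ.eq_zero_of_notMem (t := a) (by simp),
    hφ.eq_zero_of_notMem (t := b) (by simp)]
  simp

/-- The distributional derivative of `sign (· - m)` is `2 δ_m`. -/
lemma integral_sign_mul_deriv (hm : m ∈ Ioo a b) (hφ : IsTestFunction a b φ) :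
    ∫ x in Ioo a b, (SignType.sign (x - m) : ℝ) * deriv φ x = -(2 * φ m) := by
  have hi : ∀ x y, IntervalIntegrable (deriv φ) volume x y :=
    fun x y => hφ.continuous_deriv.intervalIntegrable _ _
  have e1 : ∀ᵐ x, x ∈ uIoc a m → (SignType.sign (x - m) : ℝ) * deriv φ x = (-1) * deriv φ x := by
    filter_upwards [compl_mem_ae_iff.2 (measure_singleton m)] with x hx hx'
    rw [uIoc_of_le hm.1.le] at hx'
    rw [sign_neg (sub_neg.2 (lt_of_le_of_ne hx'.2 hx))]
    simp
  have e2 : ∀ᵐ x, x ∈ uIoc m b → (SignType.sign (x - m) : ℝ) * deriv φ x = 1 * deriv φ x := by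
    refine ae_of_all _ fun x hx' => ?_
    rw [uIoc_of_le hm.2.le] at hx'
    rw [sign_pos (sub_pos.2 hx'.1)]
    simp
  have i1 : IntervalIntegrable (fun x => (SignType.sign (x - m) : ℝ) * deriv φ x) volume a m := by
    refine ((hi a m).const_mul (-1)).congr_ae ?_
    rw [EventuallyEq, ae_restrict_iff' measurableSet_uIoc]
    filter_upwards [e1] with x hx hx' using (hx hx').symm
  have i2 : IntervalIntegrable (fun x => (SignType.sign (x - m) : ℝ) * deriv φ x) volume m b := by
    refine ((hi m b).const_mul 1).congr_ae ?_
    rw [EventuallyEq, ae_restrict_iff' measurableSet_uIoc]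
    filter_upwards [e2] with x hx hx' using (hx hx').symm
  rw [← intervalIntegral_eq_setIntegral_Ioo (hm.1.trans hm.2).le,
    ← intervalIntegral.integral_add_adjacent_intervals i1 i2,
    intervalIntegral.integral_congr_ae e1, intervalIntegral.integral_congr_ae e2,
    intervalIntegral.integral_const_mul, intervalIntegral.integral_const_mul,
    integral_deriv_eq_sub_of_isTestFunction hφ, integral_deriv_eq_sub_of_isTestFunction hφ,
    hφ.eq_zero_of_notMem (t := a) (by simp), hφ.eq_zero_of_notMem (t := b) (by simp)]
  ring

/-- A test function with vanishing integral is the derivative of a test function. -/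
lemma IsTestFunction.exists_deriv_eq (hab : a < b) (hψ : IsTestFunction a b ψ)
    (h0 : ∫ x in Ioo a b, ψ x = 0) : ∃ φ, IsTestFunction a b φ ∧ deriv φ = ψ := by
  have hcont := hψ.1.continuous
  have hint : ∀ x y, IntervalIntegrable ψ volume x y := fun x y => hcont.intervalIntegrable _ _
  have hder : ∀ x, HasDerivAt (fun x => ∫ y in a..x, ψ y) (ψ x) x := fun x =>
    intervalIntegral.integral_hasDerivAt_right (hint _ _)
      (hcont.stronglyMeasurableAtFilter _ _) hcont.continuousAt
  have hd : deriv (fun x => ∫ y in a..x, ψ y) = ψ := funext fun x => (hder x).deriv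
  -- The midpoint is added only to make `K` nonempty, so that its infimum and supremum are attained
  -- inside `(a,b)` even when `ψ = 0`.
  obtain ⟨K, hK⟩ : ∃ K, K = insert ((a + b) / 2) (tsupport ψ) := ⟨_, rfl⟩
  have hKc : IsCompact K := by rw [hK]; exact hψ.2.1.insert _
  have hKn : K.Nonempty := by rw [hK]; exact insert_nonempty _ _
  have hKs : K ⊆ Ioo a b := by
    rw [hK]
    exact insert_subset ⟨by linarith, by linarith⟩ hψ.2.2
  have ha' := hKs (hKc.sInf_mem hKn)
  have hb' := hKs (hKc.sSup_mem hKn)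
  have hz : ∀ x, x ∉ Icc (sInf K) (sSup K) → ψ x = 0 := fun x hx => by
    refine image_eq_zero_of_notMem_tsupport fun hx' => hx ?_
    have hxK : x ∈ K := by rw [hK]; exact mem_insert_of_mem _ hx'
    exact ⟨csInf_le hKc.bddBelow hxK, le_csSup hKc.bddAbove hxK⟩
  have hsupp : Function.support (fun x => ∫ y in a..x, ψ y) ⊆ Icc (sInf K) (sSup K) := by
    intro x hx
    by_contra hx'
    apply hx
    rw [mem_Icc, not_and_or, not_le, not_le] at hx'
    rcases hx' with hx' | hx'
    · refine intervalIntegral.integral_zero_ae (ae_of_all _ fun y hy => hz y fun hy' => ?_)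
      rcases mem_uIoc.1 hy with hy | hy
      · linarith [hy.2, hy'.1]
      · linarith [hy.2, hy'.1, ha'.1]
    · have : ∫ y in a..x, ψ y = (∫ y in a..b, ψ y) + ∫ y in b..x, ψ y :=
        (intervalIntegral.integral_add_adjacent_intervals (hint _ _) (hint _ _)).symm
      simp only [this, intervalIntegral_eq_setIntegral_Ioo hab.le, h0, zero_add]
      refine intervalIntegral.integral_zero_ae (ae_of_all _ fun y hy => hz y fun hy' => ?_)
      rcases mem_uIoc.1 hy with hy | hy
      · linarith [hy.1, hy'.2, hb'.2]
      · linarith [hy.1, hy'.2, hb'.2]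
  refine ⟨fun x => ∫ y in a..x, ψ y, ⟨?_, ?_, ?_⟩, hd⟩
  · rw [contDiff_infty_iff_deriv, hd]
    exact ⟨fun x => (hder x).differentiableAt, hψ.1⟩
  · exact HasCompactSupport.of_support_subset_isCompact isCompact_Icc hsupp
  · exact (closure_minimal hsupp isClosed_Icc).trans (Icc_subset_Ioo ha'.1 hb'.2)

/-- Du Bois-Reymond: a function with vanishing weak derivative is constant. -/
lemma ae_eq_const_of_integral_mul_deriv_eq_zero (hab : a < b) (hw : IntegrableOn w (Ioo a b))
    (h : ∀ φ, IsTestFunction a b φ → ∫ x in Ioo a b, w x * deriv φ x = 0) :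
    ∃ C, ∀ᵐ x ∂volume.restrict (Ioo a b), w x = C := by
  let β : ContDiffBump ((a + b) / 2) := ⟨(b - a) / 8, (b - a) / 4, by linarith, by linarith⟩
  have hβ : IsTestFunction a b (β.normed volume) := by
    refine ⟨β.contDiff_normed, β.hasCompactSupport_normed, ?_⟩
    rw [β.tsupport_normed_eq, Real.closedBall_eq_Icc]
    exact Icc_subset_Ioo (by simp only [β]; linarith) (by simp only [β]; linarith)
  have hβ1 : ∫ x in Ioo a b, β.normed volume x = 1 := by
    rw [setIntegral_eq_integral_of_forall_compl_eq_zero fun x hx => hβ.eq_zero_of_notMem hx,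
      β.integral_normed]
  have hone : IntegrableOn (fun _ => (1 : ℝ)) (Ioo a b) := integrableOn_const (by simp)
  refine ⟨∫ x in Ioo a b, w x * β.normed volume x, ?_⟩
  set C := ∫ x in Ioo a b, w x * β.normed volume x with hC
  have key : ∀ᵐ x, x ∈ Ioo a b → w x - C = 0 := by
    refine isOpen_Ioo.ae_eq_zero_of_integral_contDiff_smul_eq_zero
      ((hw.sub (integrableOn_const (by simp))).locallyIntegrableOn) fun ψ h1 h2 h3 => ?_
    have hψ : IsTestFunction a b ψ := ⟨h1, h2, h3⟩
    have hψi : IntegrableOn ψ (Ioo a b) := by simpa using hψ.integrableOn_mul hone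
    have hβi : IntegrableOn (β.normed volume) (Ioo a b) := by simpa using hβ.integrableOn_mul hone
    set I := ∫ x in Ioo a b, ψ x with hI
    -- Subtracting the multiple `I` of a bump of unit mass leaves a test function of mean zero,
    -- which is a derivative and can be inserted into the hypothesis.
    have hψ1 : IsTestFunction a b (ψ - fun x => I * β.normed volume x) := by
      have hs : tsupport (ψ - fun x => I * β.normed volume x) ⊆
          tsupport ψ ∪ tsupport (β.normed volume) :=
        (tsupport_sub ψ _).trans
          (union_subset_union_right _ (tsupport_mul_subset_right (f := fun _ => I)))
      refine ⟨h1.sub (contDiff_const.mul hβ.1), ?_, hs.trans (union_subset h3 hβ.2.2)⟩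
      exact HasCompactSupport.of_support_subset_isCompact (h2.isCompact.union hβ.2.1.isCompact)
        ((subset_tsupport _).trans hs)
    have hψ0 : ∫ x in Ioo a b, (ψ - fun x => I * β.normed volume x) x = 0 := by
      simp only [Pi.sub_apply]
      rw [integral_sub hψi (hβi.const_mul I), integral_const_mul, hβ1, ← hI]
      ring
    obtain ⟨φ, hφ, hφd⟩ := hψ1.exists_deriv_eq hab hψ0
    have := h φ hφ
    rw [hφd] at this
    rw [← setIntegral_eq_integral_of_forall_compl_eq_zero (s := Ioo a b)
      fun x hx => by simp [hψ.eq_zero_of_notMem hx]]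
    have e1 : ∫ x in Ioo a b, w x * (ψ - fun x => I * β.normed volume x) x =
        (∫ x in Ioo a b, w x * ψ x) - I * C := by
      rw [hC, ← integral_const_mul,
        ← integral_sub (hψ.integrableOn_mul hw) ((hβ.integrableOn_mul hw).const_mul I)]
      congr 1; ext x; simp only [Pi.sub_apply]; ring
    have e2 : ∫ x in Ioo a b, ψ x • (w x - C) = (∫ x in Ioo a b, w x * ψ x) - C * I := by
      rw [hI, ← integral_const_mul, ← integral_sub (hψ.integrableOn_mul hw) (hψi.const_mul C)]
      congr 1; ext x; simp only [smul_eq_mul]; ring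
    rw [e2]
    linarith [e1, this]
  rw [ae_restrict_iff' measurableSet_Ioo]
  filter_upwards [key] with x hx hx' using by linarith [hx hx']

/-- A function in `W^{1,1}` is, up to a constant, the primitive of its weak derivative. -/
lemma HasWeakDeriv.ae_eq_primitive_add_const (hab : a < b) (h : HasWeakDeriv a b w g)
    (hc : c ∈ Icc a b) :
    ∃ C, ∀ᵐ x ∂volume.restrict (Ioo a b), w x = (∫ y in c..x, g y) + C := by
  obtain ⟨hw, hg, h⟩ := h
  obtain ⟨C, hC⟩ := ae_eq_const_of_integral_mul_deriv_eq_zero hab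
    (hw.sub (integrableOn_primitive hg hc)) fun φ hφ => by
      have e := h φ hφ
      rw [← integral_primitive_mul_deriv hg hc hφ, ← sub_eq_zero,
        ← integral_sub (hφ.integrableOn_mul_deriv hw)
          (hφ.integrableOn_mul_deriv (integrableOn_primitive hg hc))] at e
      rw [← e]
      congr 1; ext x; simp only [Pi.sub_apply]; ring
  refine ⟨C, ?_⟩
  filter_upwards [hC] with x hx
  simp only [Pi.sub_apply] at hx
  linarith

lemma hasWeakDeriv_primitive_add_const (hg : IntegrableOn g (Ioo a b)) (hc : c ∈ Icc a b) (C : ℝ) :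
    HasWeakDeriv a b (fun x => C + ∫ y in c..x, g y) g := by
  have hC : IntegrableOn (fun _ => C) (Ioo a b) := integrableOn_const (by simp)
  have hp := integrableOn_primitive hg hc
  refine ⟨hC.add hp, hg, fun φ hφ => ?_⟩
  simp_rw [add_mul]
  rw [integral_add (hφ.integrableOn_mul_deriv hC) (hφ.integrableOn_mul_deriv hp),
    integral_const_mul_deriv (hc.1.trans hc.2) C hφ, integral_primitive_mul_deriv hg hc hφ, zero_add]

lemma HasWeakDeriv.congr_ae {w' : ℝ → ℝ} (h : HasWeakDeriv a b w g)
    (hw : w =ᵐ[volume.restrict (Ioo a b)] w') : HasWeakDeriv a b w' g := by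
  refine ⟨h.1.congr hw, h.2.1, fun φ hφ => ?_⟩
  rw [← h.2.2 φ hφ]
  refine integral_congr_ae ?_
  filter_upwards [hw] with x hx
  rw [hx]

lemma HasWeakDeriv.sub {w₁ w₂ g₁ g₂ : ℝ → ℝ} (h₁ : HasWeakDeriv a b w₁ g₁)
    (h₂ : HasWeakDeriv a b w₂ g₂) :
    HasWeakDeriv a b (fun x => w₁ x - w₂ x) (fun x => g₁ x - g₂ x) := by
  refine ⟨h₁.1.sub h₂.1, h₁.2.1.sub h₂.2.1, fun φ hφ => ?_⟩
  simp_rw [sub_mul]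
  rw [integral_sub (hφ.integrableOn_mul_deriv h₁.1) (hφ.integrableOn_mul_deriv h₂.1),
    integral_sub (hφ.integrableOn_mul h₁.2.1) (hφ.integrableOn_mul h₂.2.1), h₁.2.2 φ hφ,
    h₂.2.2 φ hφ]
  ring

/-! ### The integrand `ξ ↦ √(K ξ² + W)` -/

section Integrand

variable {K W l ξ η : ℝ}

lemma sub_sq_mul_slope_eq (hK : 0 < K) (hl : 0 ≤ l) (hlK : l ^ 2 < K) :
    (K - l ^ 2) * √(l ^ 2 * W / (K * (K - l ^ 2))) = l * √((K - l ^ 2) / K * W) := by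
  have hd : 0 < K - l ^ 2 := sub_pos.2 hlK
  have e : (K - l ^ 2) ^ 2 * (l ^ 2 * W / (K * (K - l ^ 2))) = l ^ 2 * ((K - l ^ 2) / K * W) := by
    field_simp
  have := congrArg Real.sqrt e
  rwa [Real.sqrt_mul (sq_nonneg _), Real.sqrt_mul (sq_nonneg _), Real.sqrt_sq hd.le,
    Real.sqrt_sq hl] at this

/-- Completing the square: the difference between the squared integrand and the squared affine
function is a nonnegative multiple of the squared distance to the slope. The affine bound, its
equality case and the quantitative estimate below all come from this identity. -/
lemma sub_sq_mul_sub_slope_sq_eq (hK : 0 < K) (hW : 0 ≤ W) (hl : 0 ≤ l) (hlK : l ^ 2 < K) :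
    (K - l ^ 2) * (ξ - √(l ^ 2 * W / (K * (K - l ^ 2)))) ^ 2 =
      (K * |ξ| ^ 2 + W) - (l * ξ + √((K - l ^ 2) / K * W)) ^ 2 := by
  have hd : 0 < K - l ^ 2 := sub_pos.2 hlK
  have e1 := sub_sq_mul_slope_eq (W := W) hK hl hlK
  have e2 : √(l ^ 2 * W / (K * (K - l ^ 2))) ^ 2 = l ^ 2 * W / (K * (K - l ^ 2)) :=
    Real.sq_sqrt (by positivity)
  have e3 : √((K - l ^ 2) / K * W) ^ 2 = (K - l ^ 2) / K * W := Real.sq_sqrt (by positivity)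
  have e4 : (K - l ^ 2) * (l ^ 2 * W / (K * (K - l ^ 2))) + (K - l ^ 2) / K * W = W := by
    field_simp
    ring
  rw [sq_abs]
  linear_combination (-2 * ξ) * e1 + (K - l ^ 2) * e2 + e3 + e4

lemma affine_le_sqrt (hK : 0 < K) (hW : 0 ≤ W) (hl : 0 ≤ l) (hlK : l ^ 2 < K) :
    l * ξ + √((K - l ^ 2) / K * W) ≤ √(K * |ξ| ^ 2 + W) := by
  refine Real.le_sqrt_of_sq_le ?_
  have := sub_sq_mul_sub_slope_sq_eq (ξ := ξ) hK hW hl hlK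
  have h2 : 0 ≤ (K - l ^ 2) * (ξ - √(l ^ 2 * W / (K * (K - l ^ 2)))) ^ 2 :=
    mul_nonneg (sub_pos.2 hlK).le (sq_nonneg _)
  linarith

lemma sqrt_at_slope_eq_affine (hK : 0 < K) (hW : 0 ≤ W) (hl : 0 ≤ l) (hlK : l ^ 2 < K) :
    √(K * |√(l ^ 2 * W / (K * (K - l ^ 2)))| ^ 2 + W) =
      l * √(l ^ 2 * W / (K * (K - l ^ 2))) + √((K - l ^ 2) / K * W) := by
  have := sub_sq_mul_sub_slope_sq_eq (ξ := √(l ^ 2 * W / (K * (K - l ^ 2)))) hK hW hl hlK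
  rw [Real.sqrt_eq_iff_mul_self_eq (by positivity) (by positivity)]
  linarith

lemma sqrt_at_slope_eq (hK : 0 < K) (hW : 0 ≤ W) (hlK : l ^ 2 < K) :
    √(K * |√(l ^ 2 * W / (K * (K - l ^ 2)))| ^ 2 + W) = √(K * W / (K - l ^ 2)) := by
  have hd : 0 < K - l ^ 2 := sub_pos.2 hlK
  rw [sq_abs, Real.sq_sqrt (by positivity)]
  congr 1
  field_simp
  ring

/-- A quantitative form of the strict convexity of the integrand. -/
lemma sqrt_mul_abs_sub_slope_le (hK : 0 < K) (hW : 0 ≤ W) (hl : 0 ≤ l) (hlK : l ^ 2 < K) :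
    2 * η * (√(K - l ^ 2) * |ξ - √(l ^ 2 * W / (K * (K - l ^ 2)))|) ≤
      (1 + 2 * η ^ 2) * √(K * |ξ| ^ 2 + W) - (l * ξ + √((K - l ^ 2) / K * W)) := by
  have hd : 0 < K - l ^ 2 := sub_pos.2 hlK
  have e := sub_sq_mul_sub_slope_sq_eq (ξ := ξ) hK hW hl hlK
  have hle := affine_le_sqrt (ξ := ξ) hK hW hl hlK
  set p := √(l ^ 2 * W / (K * (K - l ^ 2)))
  set a := l * ξ + √((K - l ^ 2) / K * W)
  set F := √(K * |ξ| ^ 2 + W) with hF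
  have hF0 : 0 ≤ F := Real.sqrt_nonneg _
  have hF2 : F ^ 2 = K * |ξ| ^ 2 + W := Real.sq_sqrt (by positivity)
  -- With excess D = F − a ≥ 0, the squared distance is D(F + a) ≤ 2DF. The AM–GM inequality 8η²DF ≤
  -- (D + 2η²F)² then gives the claim; the parameter η distributes the weight between D and F.
  have hx : (√(K - l ^ 2) * |ξ - p|) ^ 2 = (F - a) * (F + a) := by
    rw [mul_pow, Real.sq_sqrt hd.le, sq_abs, e, ← hF2]
    ring
  refine abs_le_of_sq_le_sq' ?_ (by nlinarith [mul_nonneg (sq_nonneg η) hF0]) |>.2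
  have h1 : (F - a) * (F + a) ≤ (F - a) * (2 * F) :=
    mul_le_mul_of_nonneg_left (by linarith) (by linarith)
  calc (2 * η * (√(K - l ^ 2) * |ξ - p|)) ^ 2
      = 4 * η ^ 2 * ((F - a) * (F + a)) := by rw [mul_pow, hx]; ring
    _ ≤ 4 * η ^ 2 * ((F - a) * (2 * F)) := by gcongr
    _ = 4 * ((F - a) * (2 * η ^ 2 * F)) := by ring
    _ ≤ ((1 + 2 * η ^ 2) * F - a) ^ 2 := by nlinarith [sq_nonneg ((F - a) - 2 * η ^ 2 * F)]

/-- The integrand is √K-Lipschitz in ξ, so a steep ramp costs at most √K times its height. This is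
the price of a jump. -/
lemma sqrt_add_le_sqrt_add_mul {δ : ℝ} (hK : 0 ≤ K) (hW : 0 ≤ W) (hδ : 0 ≤ δ) :
    √(K * |ξ + δ| ^ 2 + W) ≤ √(K * |ξ| ^ 2 + W) + √K * δ := by
  rw [Real.sqrt_le_left (by positivity), add_sq, Real.sq_sqrt (by positivity), mul_pow,
    Real.sq_sqrt hK, sq_abs, sq_abs]
  have : √K * |ξ| ≤ √(K * |ξ| ^ 2 + W) := by
    refine Real.le_sqrt_of_sq_le ?_
    rw [mul_pow, Real.sq_sqrt hK]
    linarith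
  have h2 : K * ξ ≤ √(K * |ξ| ^ 2 + W) * √K := by
    calc K * ξ ≤ K * |ξ| := by gcongr; exact le_abs_self _
      _ = (√K * |ξ|) * √K := by rw [mul_right_comm, Real.mul_self_sqrt hK]
      _ ≤ _ := by gcongr
  rw [sq_abs] at h2
  nlinarith [mul_le_mul_of_nonneg_right h2 hδ]

lemma slope_strictMono {l' : ℝ} (hK : 0 < K) (hW : 0 < W) (hl : 0 ≤ l) (hll : l < l')
    (hlK : l' ^ 2 < K) :
    √(l ^ 2 * W / (K * (K - l ^ 2))) < √(l' ^ 2 * W / (K * (K - l' ^ 2))) := by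
  have h1 : l ^ 2 < l' ^ 2 := by gcongr
  have hd : 0 < K - l ^ 2 := by linarith
  have hd' : 0 < K - l' ^ 2 := by linarith
  refine Real.sqrt_lt_sqrt (by positivity) ?_
  gcongr

end Integrand

/-! ### The even extensions -/

section Profile

variable {f Q ω : ℝ → ℝ} {m l t : ℝ}

lemma Hypotheses.kHat_pos (h : Hypotheses f Q ω) (ht : t ∈ Ioo (0 : ℝ) 1) : 0 < kHat f Q ω t := by
  have h0 : kHat f Q ω 0 = 0 := by
    simp [kHat, (h.f_zero 0 (by simp)).2 rfl]
  rw [← h0]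
  exact h.k_strictMono (by simp) ⟨ht.1.le, ht.2⟩ ht.1

lemma Hypotheses.kHat_continuousOn (h : Hypotheses f Q ω) :
    ContinuousOn (kHat f Q ω) (Ico 0 1) := by
  have hmaps : MapsTo (fun t : ℝ => 1 - t) (Ico 0 1) (Icc 0 1) := fun t ht =>
    ⟨by linarith [ht.2], by linarith [ht.1]⟩
  refine ((h.ω_cont.comp (by fun_prop) hmaps).div (h.Q_cont.comp (by fun_prop) hmaps)
    fun t ht => ?_).mul (h.f_cont.mono Ico_subset_Icc_self)
  intro h0
  have := (h.Q_zero _ (hmaps ht)).1 h0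
  linarith [ht.2]

lemma even_mem (ht : t ∈ Ioo (2 * m - 1) 1) : m + |t - m| ∈ Ico m 1 := by
  refine ⟨by linarith [abs_nonneg (t - m)], ?_⟩
  have : |t - m| < 1 - m := abs_lt.2 ⟨by linarith [ht.1], by linarith [ht.2]⟩
  linarith

lemma even_eq (ht : m ≤ t) : m + |t - m| = t := by
  rw [abs_of_nonneg (sub_nonneg.2 ht)]
  ring

lemma kEven_eq (ht : m ≤ t) : kEven f Q ω m t = kHat f Q ω t := by rw [kEven, even_eq ht]

lemma omegaEven_eq (ht : m ≤ t) : omegaEven ω m t = ω (1 - t) := by rw [omegaEven, even_eq ht]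

lemma kEven_reflect : kEven f Q ω m (2 * m - t) = kEven f Q ω m t := by
  rw [kEven, kEven, ← abs_neg]
  congr 3
  ring

lemma omegaEven_reflect : omegaEven ω m (2 * m - t) = omegaEven ω m t := by
  rw [omegaEven, omegaEven, ← abs_neg]
  congr 4
  ring

lemma slope_reflect : slope f Q ω m l (2 * m - t) = slope f Q ω m l t := by
  rw [slope, slope, kEven_reflect, omegaEven_reflect]

variable (h : Hypotheses f Q ω) (hm : m ∈ Ioo (0 : ℝ) 1)

include h hm

lemma kHat_le_kEven {τ : ℝ} (hτ : m ≤ τ) (hτt : τ ≤ m + |t - m|) (ht : t ∈ Ioo (2 * m - 1) 1) :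
    kHat f Q ω τ ≤ kEven f Q ω m t :=
  h.k_strictMono.monotoneOn ⟨hm.1.le.trans hτ, hτt.trans_lt (even_mem ht).2⟩
    ⟨hm.1.le.trans (even_mem ht).1, (even_mem ht).2⟩ hτt

lemma kEven_le_kHat {τ : ℝ} (hτ : τ < 1) (hτt : m + |t - m| ≤ τ) :
    kEven f Q ω m t ≤ kHat f Q ω τ := by
  have h0 : 0 ≤ m + |t - m| := by linarith [hm.1, abs_nonneg (t - m)]
  exact h.k_strictMono.monotoneOn ⟨h0, hτt.trans_lt hτ⟩ ⟨h0.trans hτt, hτ⟩ hτt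

lemma kHat_lt_kEven (ht : t ∈ Ioo (2 * m - 1) 1) (htm : t ≠ m) :
    kHat f Q ω m < kEven f Q ω m t :=
  h.k_strictMono ⟨hm.1.le, hm.2⟩ ⟨hm.1.le.trans (even_mem ht).1, (even_mem ht).2⟩
    (by linarith [abs_pos.2 (sub_ne_zero.2 htm)])

lemma kEven_pos (ht : t ∈ Ioo (2 * m - 1) 1) : 0 < kEven f Q ω m t :=
  h.kHat_pos ⟨hm.1.trans_le (even_mem ht).1, (even_mem ht).2⟩

lemma omegaEven_pos (ht : t ∈ Ioo (2 * m - 1) 1) : 0 < omegaEven ω m t := by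
  have h1 := even_mem ht
  have h2 : 1 - (m + |t - m|) ∈ Icc (0 : ℝ) 1 := ⟨by linarith [h1.2], by linarith [h1.1, hm.1]⟩
  refine lt_of_le_of_ne (h.ω_nonneg _ h2) fun h0 => ?_
  have := (h.ω_zero _ h2).1 h0.symm
  linarith [h1.2]

lemma kEven_continuousOn : ContinuousOn (kEven f Q ω m) (Ioo (2 * m - 1) 1) :=
  h.kHat_continuousOn.comp (by fun_prop) fun _ ht =>
    ⟨hm.1.le.trans (even_mem ht).1, (even_mem ht).2⟩

lemma omegaEven_continuousOn : ContinuousOn (omegaEven ω m) (Icc (2 * m - 1) 1) := by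
  refine h.ω_cont.comp (f := fun t => 1 - (m + |t - m|)) (by fun_prop) fun t ht => ?_
  have : |t - m| ≤ 1 - m := abs_le.2 ⟨by linarith [ht.1], by linarith [ht.2]⟩
  exact ⟨by linarith, by linarith [abs_nonneg (t - m), hm.1]⟩

lemma kEven_aemeasurable : AEMeasurable (kEven f Q ω m) (volume.restrict (Ioo (2 * m - 1) 1)) :=
  (kEven_continuousOn h hm).aemeasurable measurableSet_Ioo

lemma omegaEven_aemeasurable : AEMeasurable (omegaEven ω m) (volume.restrict (Ioo (2 * m - 1) 1)) :=
  ((omegaEven_continuousOn h hm).mono Ioo_subset_Icc_self).aemeasurable measurableSet_Ioo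

lemma slope_aemeasurable (l : ℝ) :
    AEMeasurable (slope f Q ω m l) (volume.restrict (Ioo (2 * m - 1) 1)) := by
  have h1 := kEven_aemeasurable h hm
  have h2 := omegaEven_aemeasurable h hm
  unfold slope
  fun_prop

/-- Strict monotonicity of k̂ keeps the calibration nondegenerate off m even at the extreme value λ
= √k̂(m). -/
lemma sq_lt_kEven (hl : l ∈ Icc 0 √(kHat f Q ω m)) (ht : t ∈ Ioo (2 * m - 1) 1) (htm : t ≠ m) :
    l ^ 2 < kEven f Q ω m t := by
  refine lt_of_le_of_lt ?_ (kHat_lt_kEven h hm ht htm)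
  rw [← Real.sq_sqrt (h.kHat_pos hm).le]
  have := hl.1
  gcongr
  exact hl.2

end Profile

/-- The point m is discarded throughout, because k̂_m − λ² vanishes there when λ = √k̂(m). -/
lemma ae_restrict_mem_and_ne (m : ℝ) :
    ∀ᵐ t ∂volume.restrict (Ioo (2 * m - 1) 1), t ∈ Ioo (2 * m - 1) 1 ∧ t ≠ m := by
  filter_upwards [ae_restrict_mem measurableSet_Ioo,
    ae_restrict_of_ae (compl_mem_ae_iff.2 (measure_singleton m))] with t h1 h2 using ⟨h1, h2⟩

/-- The integral of an even function. -/
lemma lintegral_Ioo_eq_two_mul {m : ℝ} (hm : m < 1) {F G : ℝ → ℝ≥0∞} (hF : ∀ t, F (2 * m - t) = F t)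
    (hG : ∀ t ∈ Ioo m 1, F t = G t) :
    ∫⁻ t in Ioo (2 * m - 1) 1, F t = 2 * ∫⁻ t in Ioo m 1, G t := by
  have hpre : (fun t => 2 * m - t) ⁻¹' Ioo (2 * m - 1) m = Ioo m 1 := by
    ext t; simp only [mem_preimage, mem_Ioo]; constructor <;> rintro ⟨_, _⟩ <;> constructor <;> linarith
  have e1 : ∫⁻ t in Ioo (2 * m - 1) m, F t = ∫⁻ t in Ioo m 1, G t := by
    rw [← setLIntegral_congr_fun measurableSet_Ioo hG, ← hpre]
    rw [← (Measure.measurePreserving_sub_left volume (2 * m)).setLIntegral_comp_preimage_emb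
      (Homeomorph.subLeft (2 * m)).measurableEmbedding]
    simp_rw [hF]
  have e2 : ∫⁻ t in Ico m 1, F t = ∫⁻ t in Ioo m 1, G t := by
    rw [← setLIntegral_congr_fun measurableSet_Ioo hG]
    exact setLIntegral_congr Ioo_ae_eq_Ico.symm
  rw [← Ioo_union_Ico_eq_Ioo (a := 2 * m - 1) (b := m) (by linarith) hm.le,
    lintegral_union measurableSet_Ico, e1, e2, two_mul]
  exact Set.disjoint_left.2 fun x hx hx' => absurd hx.2 (not_lt.2 hx'.1)

/-! ### The lower bound and the uniqueness of the minimizer -/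

lemma ofReal_integral_le_lintegral_ofReal {α : Type*} [MeasurableSpace α] {μ : Measure α}
    {F : α → ℝ} (hF : Integrable F μ) :
    ENNReal.ofReal (∫ x, F x ∂μ) ≤ ∫⁻ x, ENNReal.ofReal (F x) ∂μ := by
  have hpos : Integrable (fun x => max (F x) 0) μ := hF.pos_part
  calc ENNReal.ofReal (∫ x, F x ∂μ)
      ≤ ENNReal.ofReal (∫ x, max (F x) 0 ∂μ) :=
        ENNReal.ofReal_le_ofReal (integral_mono hF hpos fun x => le_max_left _ _)
    _ = ∫⁻ x, ENNReal.ofReal (max (F x) 0) ∂μ :=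
        ofReal_integral_eq_lintegral_ofReal hpos (ae_of_all _ fun x => le_max_right _ _)
    _ = ∫⁻ x, ENNReal.ofReal (F x) ∂μ := by simp

variable {f Q ω g p u : ℝ → ℝ} {m s l δ η : ℝ}

/-- The minimal value `√((k̂_m - λ²) / k̂_m ω_m)` of `ξ ↦ √(k̂_m ξ² + ω_m) - λ ξ`. -/
noncomputable def dualDensity (f Q ω : ℝ → ℝ) (m l t : ℝ) : ℝ :=
  √((kEven f Q ω m t - l ^ 2) / kEven f Q ω m t * omegaEven ω m t)

lemma continuous_zeta (m s : ℝ) : Continuous (zeta m s) := by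
  unfold zeta
  fun_prop

lemma zeta_left (m s : ℝ) : zeta m s (2 * m - 1) = 0 := by simp [zeta]

lemma zeta_right (hm : m < 1) : zeta m s 1 = s := by
  have : 2 * (1 - m) ≠ 0 := by linarith
  rw [zeta, div_eq_iff this]
  ring

/-- Competitors are primitives of their weak derivatives, with the prescribed boundary values. -/
lemma eq_primitive_of_memW11Zero (hm : m < 1) {y : ℝ → ℝ}
    (hy : MemW11Zero (2 * m - 1) 1 (fun t => y t - zeta m s t))
    (hg : HasWeakDeriv (2 * m - 1) 1 y g) :
    (∀ᵐ t ∂volume.restrict (Ioo (2 * m - 1) 1), y t = ∫ x in (2 * m - 1)..t, g x) ∧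
      ∫ x in (2 * m - 1)..1, g x = s := by
  have hab : 2 * m - 1 < 1 := by linarith
  obtain ⟨-, v, hvc, hv, hva, hvb⟩ := hy
  have hc : 2 * m - 1 ∈ Icc (2 * m - 1) 1 := left_mem_Icc.2 hab.le
  obtain ⟨C, hC⟩ := hg.ae_eq_primitive_add_const hab hc
  have hae : v =ᵐ[volume.restrict (Icc (2 * m - 1) 1)]
      fun t => (∫ x in (2 * m - 1)..t, g x) + C - zeta m s t := by
    rw [← Measure.restrict_congr_set Ioo_ae_eq_Icc]
    filter_upwards [hC, hv] with t h1 h2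
    rw [h2, h1]
  -- Continuous functions that agree a.e. agree on the closed interval, so the zero boundary values
  -- of `v` determine both the constant `C` and the total integral of `g`.
  have heq := Measure.eqOn_Icc_of_ae_eq volume hab.ne hae hvc
    (((continuousOn_primitive hg.2.1 hc).add continuousOn_const).sub
      (continuous_zeta m s).continuousOn)
  have h1 := heq hc
  have h2 := heq (right_mem_Icc.2 hab.le)
  simp only [hva, hvb, intervalIntegral.integral_same, zeta_left, zeta_right hm] at h1 h2
  have hC0 : C = 0 := by linarith
  subst hC0
  refine ⟨?_, by linarith⟩
  filter_upwards [hC] with t ht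
  rw [ht, add_zero]

lemma abs_intervalIntegral_le_of_subset {F : ℝ → ℝ} {a b x y : ℝ} {E : Set ℝ} (hE : MeasurableSet E)
    (hF : IntegrableOn F (Ioo a b)) (hxy : x ≤ y) (hax : a ≤ x) (hyb : y ≤ b) (hsub : Ioo x y ⊆ E) :
    |∫ t in x..y, F t| ≤ ∫ t in E, |F t| ∂volume.restrict (Ioo a b) := by
  rw [intervalIntegral_eq_setIntegral_Ioo hxy, Measure.restrict_restrict hE]
  refine (abs_integral_le_integral_abs).trans (setIntegral_mono_set ?_ ?_ ?_)
  · exact (hF.mono_set inter_subset_right).abs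
  · exact ae_of_all _ fun t => abs_nonneg _
  · exact (subset_inter hsub (Ioo_subset_Ioo hax hyb)).eventuallyLE

/-- Distance of two functions with the same boundary values, away from `m`. -/
lemma abs_sub_le_setIntegral_abs_sub (hδ : 0 ≤ δ)
    (hg : IntegrableOn g (Ioo (2 * m - 1) 1)) (hp : IntegrableOn p (Ioo (2 * m - 1) 1))
    (hgs : ∫ x in (2 * m - 1)..1, g x = s)
    (hul : ∀ t ∈ Ioo (2 * m - 1) m, u t = ∫ x in (2 * m - 1)..t, p x)
    (hur : ∀ t ∈ Ioo m 1, u t = s - ∫ x in t..1, p x) {t : ℝ} (ht : t ∈ Ioo (2 * m - 1) 1)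
    (htδ : δ < |t - m|) :
    |(∫ x in (2 * m - 1)..t, g x) - u t| ≤
      ∫ x in {x | δ < |x - m|}, |g x - p x| ∂volume.restrict (Ioo (2 * m - 1) 1) := by
  have hE : MeasurableSet {x : ℝ | δ < |x - m|} :=
    measurableSet_lt measurable_const (by fun_prop)
  have ha : 2 * m - 1 ∈ Icc (2 * m - 1) 1 := ⟨le_rfl, by linarith [ht.1, ht.2]⟩
  have hb : 1 ∈ Icc (2 * m - 1) 1 := ⟨by linarith [ht.1, ht.2], le_rfl⟩
  have ht' : t ∈ Icc (2 * m - 1) 1 := Ioo_subset_Icc_self ht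
  -- The difference is integrated from the endpoint on the same side of m as t. That path stays in
  -- {|x − m| > δ} and never meets the jump of `u`.
  rcases lt_abs.1 htδ with hlt | hlt
  · have e : (∫ x in (2 * m - 1)..t, g x) = s - ∫ x in t..1, g x := by
      rw [← hgs, ← intervalIntegral.integral_add_adjacent_intervals
        (intervalIntegrable_of_integrableOn_Ioo hg ha ht')
        (intervalIntegrable_of_integrableOn_Ioo hg ht' hb)]
      ring
    rw [e, hur t ⟨by linarith, ht.2⟩, sub_sub_sub_cancel_left, abs_sub_comm,
      ← intervalIntegral.integral_sub (intervalIntegrable_of_integrableOn_Ioo hg ht' hb)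
        (intervalIntegrable_of_integrableOn_Ioo hp ht' hb)]
    refine abs_intervalIntegral_le_of_subset hE (hg.sub hp) ht.2.le ht.1.le le_rfl fun x hx => ?_
    exact (lt_abs.2 (Or.inl (by linarith [hx.1])) : δ < |x - m|)
  · rw [hul t ⟨ht.1, by linarith⟩,
      ← intervalIntegral.integral_sub (intervalIntegrable_of_integrableOn_Ioo hg ha ht')
        (intervalIntegrable_of_integrableOn_Ioo hp ha ht')]
    refine abs_intervalIntegral_le_of_subset hE (hg.sub hp) ht.1.le le_rfl ht.2.le fun x hx => ?_
    exact (lt_abs.2 (Or.inr (by linarith [hx.2])) : δ < |x - m|)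

section LowerBound

variable (h : Hypotheses f Q ω) (hm : m ∈ Ioo (0 : ℝ) 1)

include h hm

lemma dualDensity_integrable (l : ℝ) :
    IntegrableOn (dualDensity f Q ω m l) (Ioo (2 * m - 1) 1) := by
  have h1 := kEven_aemeasurable h hm
  have h2 := omegaEven_aemeasurable h hm
  have hW : IntegrableOn (fun t => √(omegaEven ω m t)) (Ioo (2 * m - 1) 1) :=
    (((omegaEven_continuousOn h hm).sqrt).integrableOn_compact isCompact_Icc).mono_set
      Ioo_subset_Icc_self
  -- The factor (k̂_m − λ²)/k̂_m is at most 1, so √ω_m dominates whatever k̂ does near the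
  -- endpoints.
  refine hW.mono' (AEMeasurable.aestronglyMeasurable (by unfold dualDensity; fun_prop)) ?_
  filter_upwards [ae_restrict_mem measurableSet_Ioo] with t ht
  rw [dualDensity, Real.norm_of_nonneg (Real.sqrt_nonneg _)]
  refine Real.sqrt_le_sqrt (mul_le_of_le_one_left (omegaEven_pos h hm ht).le ?_)
  rw [div_le_one (kEven_pos h hm ht)]
  linarith [sq_nonneg l]

/-- The calibration estimate, with a remainder controlling the distance to the slope. -/
lemma calibration_le (hl : l ∈ Icc 0 √(kHat f Q ω m))
    (hp : IntegrableOn (slope f Q ω m l) (Ioo (2 * m - 1) 1))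
    (hg : IntegrableOn g (Ioo (2 * m - 1) 1)) (hgs : ∫ x in (2 * m - 1)..1, g x = s)
    (hδ : 0 ≤ δ) (hδm : m + δ < 1) (hη : 0 ≤ η) :
    ENNReal.ofReal ((l * s + ∫ t in Ioo (2 * m - 1) 1, dualDensity f Q ω m l t) +
      2 * η * (√(kHat f Q ω (m + δ) - l ^ 2) * ∫ t in {t | δ < |t - m|},
        |g t - slope f Q ω m l t| ∂volume.restrict (Ioo (2 * m - 1) 1))) ≤
      ENNReal.ofReal (1 + 2 * η ^ 2) * ∫⁻ t in Ioo (2 * m - 1) 1,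
        ENNReal.ofReal √(kEven f Q ω m t * |g t| ^ 2 + omegaEven ω m t) := by
  have hab : 2 * m - 1 ≤ 1 := by linarith [hm.2]
  set κ := √(kHat f Q ω (m + δ) - l ^ 2) with hκ
  have hE : MeasurableSet {x : ℝ | δ < |x - m|} :=
    measurableSet_lt measurable_const (by fun_prop)
  have hc := dualDensity_integrable h hm l
  have hd : Integrable ({t | δ < |t - m|}.indicator fun t => |g t - slope f Q ω m l t|)
      (volume.restrict (Ioo (2 * m - 1) 1)) := ((hg.sub hp).abs).indicator hE
  have hlc : Integrable (fun t => l * g t + dualDensity f Q ω m l t)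
      (volume.restrict (Ioo (2 * m - 1) 1)) := (hg.const_mul l).add hc
  have hd' : Integrable (fun t => 2 * η * (κ *
      {t | δ < |t - m|}.indicator (fun t => |g t - slope f Q ω m l t|) t))
      (volume.restrict (Ioo (2 * m - 1) 1)) := (hd.const_mul κ).const_mul (2 * η)
  have hsum : Integrable (fun t => (l * g t + dualDensity f Q ω m l t) + 2 * η * (κ *
      {t | δ < |t - m|}.indicator (fun t => |g t - slope f Q ω m l t|) t))
      (volume.restrict (Ioo (2 * m - 1) 1)) := hlc.add hd'
  have e : (l * s + ∫ t in Ioo (2 * m - 1) 1, dualDensity f Q ω m l t) +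
      2 * η * (κ * ∫ t in {t | δ < |t - m|},
        |g t - slope f Q ω m l t| ∂volume.restrict (Ioo (2 * m - 1) 1)) =
      ∫ t in Ioo (2 * m - 1) 1, ((l * g t + dualDensity f Q ω m l t) + 2 * η * (κ *
        {t | δ < |t - m|}.indicator (fun t => |g t - slope f Q ω m l t|) t)) := by
    rw [integral_add hlc hd',
      integral_add (hg.const_mul l) hc, integral_const_mul, integral_const_mul, integral_const_mul,
      integral_indicator hE, ← intervalIntegral_eq_setIntegral_Ioo hab g, hgs]
  rw [e, ← lintegral_const_mul' _ _ ENNReal.ofReal_ne_top]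
  -- The affine minorant may be negative where `g` is, so passing to the `ℝ≥0∞` integral gives only
  -- an inequality.
  refine (ofReal_integral_le_lintegral_ofReal hsum).trans ?_
  refine lintegral_mono_ae ?_
  filter_upwards [ae_restrict_mem_and_ne m] with t ⟨ht, htm⟩
  rw [← ENNReal.ofReal_mul (by positivity)]
  refine ENNReal.ofReal_le_ofReal ?_
  have hK := kEven_pos h hm ht
  have hW := omegaEven_pos h hm ht
  have hlK := sq_lt_kEven h hm hl ht htm
  have hmain := sqrt_mul_abs_sub_slope_le (ξ := g t) (η := η) hK hW.le hl.1 hlK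
  have hle := affine_le_sqrt (ξ := g t) hK hW.le hl.1 hlK
  simp only [indicator, mem_ofPred_eq]
  -- Where |t − m| > δ the quantitative estimate applies with coefficient at least κ; nearer to m,
  -- where the coefficient may degenerate, the plain affine bound is enough.
  split_ifs with hδt
  · have hκ' : κ ≤ √(kEven f Q ω m t - l ^ 2) := Real.sqrt_le_sqrt
      (sub_le_sub_right (kHat_le_kEven h hm (by linarith) (by linarith) ht) _)
    have : 2 * η * (κ * |g t - slope f Q ω m l t|) ≤
        2 * η * (√(kEven f Q ω m t - l ^ 2) * |g t - slope f Q ω m l t|) := by gcongr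
    simp only [slope, dualDensity] at this ⊢
    linarith
  · have : 0 ≤ 2 * η ^ 2 * √(kEven f Q ω m t * |g t| ^ 2 + omegaEven ω m t) := by positivity
    simp only [dualDensity]
    linarith

end LowerBound

lemma le_lscEnvelope {X : Type*} [TopologicalSpace X] {F H : X → ℝ≥0∞}
    (hH : LowerSemicontinuous H) (hle : ∀ y, H y ≤ F y) (x : X) : H x ≤ lscEnvelope F x :=
  le_iSup (fun H : {H : X → ℝ≥0∞ // LowerSemicontinuous H ∧ ∀ y, H y ≤ F y} => H.1 x) ⟨H, hH, hle⟩

lemma le_GFunDirichlet {C : ℝ≥0∞} {y : L1 m}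
    (hC : MemW11Zero (2 * m - 1) 1 (fun t => y t - zeta m s t) →
      ∀ g, HasWeakDeriv (2 * m - 1) 1 y g → C ≤ ∫⁻ t in Ioo (2 * m - 1) 1,
        ENNReal.ofReal √(kEven f Q ω m t * |g t| ^ 2 + omegaEven ω m t)) :
    C ≤ GFunDirichlet f Q ω m s y := by
  unfold GFunDirichlet
  split_ifs with hy
  · exact le_iInf₂ fun g hg => hC hy g hg
  · exact le_top

section LowerBound

variable (h : Hypotheses f Q ω) (hm : m ∈ Ioo (0 : ℝ) 1) (hl : l ∈ Icc 0 √(kHat f Q ω m))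
  (hp : IntegrableOn (slope f Q ω m l) (Ioo (2 * m - 1) 1))

include h hm hl hp

/-- The lower bound for the relaxed functional. -/
lemma ofReal_le_scG (v : L1 m) :
    ENNReal.ofReal (l * s + ∫ t in Ioo (2 * m - 1) 1, dualDensity f Q ω m l t) ≤
      scG f Q ω m s v := by
  refine le_lscEnvelope (H := fun _ => _) lowerSemicontinuous_const (fun y => ?_) v
  refine le_GFunDirichlet fun hy g hg => ?_
  have := calibration_le h hm hl hp hg.2.1 (eq_primitive_of_memW11Zero hm.2 hy hg).2
    le_rfl (by linarith [hm.2]) (le_refl (0 : ℝ))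
  simpa using this

/-- The left side is a continuous function of v in L¹, so it suffices to bound the energy of Sobolev
competitors. For them `calibration_le` controls the L¹ distance of the derivatives on {|t − m| > δ},
hence the pointwise distance to `u` there. The divisor 2(1 − m) is the length of the interval. -/
lemma ofReal_div_le_scG
    (hul : ∀ t ∈ Ioo (2 * m - 1) m, u t = ∫ x in (2 * m - 1)..t, slope f Q ω m l x)
    (hur : ∀ t ∈ Ioo m 1, u t = s - ∫ x in t..1, slope f Q ω m l x)
    (w : L1 m) (hw : u =ᵐ[volume.restrict (Ioo (2 * m - 1) 1)] w)
    (hδ : 0 ≤ δ) (hδm : m + δ < 1) (hη : 0 ≤ η) {S : Set ℝ}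
    (hSδ : S ⊆ {t | δ < |t - m|}) (v : L1 m) :
    ENNReal.ofReal (((l * s + ∫ t in Ioo (2 * m - 1) 1, dualDensity f Q ω m l t) +
      2 * η * (√(kHat f Q ω (m + δ) - l ^ 2) *
        (|(∫ t in S, v t ∂volume.restrict (Ioo (2 * m - 1) 1)) -
          ∫ t in S, w t ∂volume.restrict (Ioo (2 * m - 1) 1)| / (2 * (1 - m))))) /
      (1 + 2 * η ^ 2)) ≤ scG f Q ω m s v := by
  have hη2 : 0 < 1 + 2 * η ^ 2 := by positivity
  have hm2 : 0 < 2 * (1 - m) := by linarith [hm.2]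
  refine le_lscEnvelope (H := fun v : L1 m => ENNReal.ofReal
    (((l * s + ∫ t in Ioo (2 * m - 1) 1, dualDensity f Q ω m l t) +
      2 * η * (√(kHat f Q ω (m + δ) - l ^ 2) *
        (|(∫ t in S, v t ∂volume.restrict (Ioo (2 * m - 1) 1)) -
          ∫ t in S, w t ∂volume.restrict (Ioo (2 * m - 1) 1)| / (2 * (1 - m))))) /
      (1 + 2 * η ^ 2))) ?_ (fun y => ?_) v
  · refine (ENNReal.continuous_ofReal.comp ?_).lowerSemicontinuous
    have := continuous_setIntegral (E := ℝ) (μ := volume.restrict (Ioo (2 * m - 1) 1)) S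
    fun_prop
  refine le_GFunDirichlet fun hy g hg => ?_
  obtain ⟨hyg, hgs⟩ := eq_primitive_of_memW11Zero hm.2 hy hg
  have hcal := calibration_le h hm hl hp hg.2.1 hgs hδ hδm hη
  rw [ENNReal.ofReal_div_of_pos hη2]
  refine ENNReal.div_le_of_le_mul' (le_trans (ENNReal.ofReal_le_ofReal ?_) hcal)
  set X := ∫ t in {t | δ < |t - m|}, |g t - slope f Q ω m l t|
    ∂volume.restrict (Ioo (2 * m - 1) 1)
  have hint : ∀ z : L1 m, Integrable z (volume.restrict (Ioo (2 * m - 1) 1)) :=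
    fun z => L1.integrable_coeFn z
  have hbound : |(∫ t in S, y t ∂volume.restrict (Ioo (2 * m - 1) 1)) -
      ∫ t in S, w t ∂volume.restrict (Ioo (2 * m - 1) 1)| ≤ X * (2 * (1 - m)) := by
    rw [← integral_sub (hint y).integrableOn (hint w).integrableOn]
    have hX : 0 ≤ X := integral_nonneg fun t => abs_nonneg _
    have hvol : (volume.restrict (Ioo (2 * m - 1) 1)).real S ≤ 2 * (1 - m) := by
      refine (measureReal_mono (subset_univ S)).trans (le_of_eq ?_)
      rw [measureReal_restrict_apply_univ, Real.volume_real_Ioo_of_le (by linarith)]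
      ring
    refine le_trans (norm_setIntegral_le_of_norm_le_const_ae' (f := fun t => y t - w t) (C := X)
      (measure_lt_top (volume.restrict (Ioo (2 * m - 1) 1)) S) ?_)
      (mul_le_mul_of_nonneg_left hvol hX)
    filter_upwards [hyg, hw, ae_restrict_mem measurableSet_Ioo] with t h1 h2 h3 hSt
    rw [← h2, h1]
    exact abs_sub_le_setIntegral_abs_sub hδ hg.2.1 hp hgs hul hur h3 (hSδ hSt)
  gcongr
  rwa [div_le_iff₀ hm2]

/-- A function whose relaxed energy does not exceed the lower bound is the candidate. -/
lemma eq_of_scG_le (hl0 : 0 ≤ s)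
    (hul : ∀ t ∈ Ioo (2 * m - 1) m, u t = ∫ x in (2 * m - 1)..t, slope f Q ω m l x)
    (hur : ∀ t ∈ Ioo m 1, u t = s - ∫ x in t..1, slope f Q ω m l x)
    (w : L1 m) (hw : u =ᵐ[volume.restrict (Ioo (2 * m - 1) 1)] w) (v : L1 m)
    (hv : scG f Q ω m s v ≤
      ENNReal.ofReal (l * s + ∫ t in Ioo (2 * m - 1) 1, dualDensity f Q ω m l t)) : v = w := by
  have hA : 0 ≤ ∫ t in Ioo (2 * m - 1) 1, dualDensity f Q ω m l t :=
    integral_nonneg fun t => Real.sqrt_nonneg _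
  have hM : 0 ≤ l * s + ∫ t in Ioo (2 * m - 1) 1, dualDensity f Q ω m l t :=
    add_nonneg (mul_nonneg hl.1 hl0) hA
  have hint : ∀ z : L1 m, Integrable z (volume.restrict (Ioo (2 * m - 1) 1)) :=
    fun z => L1.integrable_coeFn z
  have hm2 : 0 < 2 * (1 - m) := by linarith [hm.2]
  have hset : ∀ δ, 0 < δ → m + δ < 1 → ∀ S, S ⊆ {t | δ < |t - m|} →
      ∫ t in S, v t ∂volume.restrict (Ioo (2 * m - 1) 1) =
        ∫ t in S, w t ∂volume.restrict (Ioo (2 * m - 1) 1) := by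
    intro δ hδ hδm S hSδ
    set M := l * s + ∫ t in Ioo (2 * m - 1) 1, dualDensity f Q ω m l t
    set x := |(∫ t in S, v t ∂volume.restrict (Ioo (2 * m - 1) 1)) -
          ∫ t in S, w t ∂volume.restrict (Ioo (2 * m - 1) 1)| / (2 * (1 - m)) with hx
    have hκ : 0 < √(kHat f Q ω (m + δ) - l ^ 2) := by
      refine Real.sqrt_pos.2 (sub_pos.2 ?_)
      have h1 : kHat f Q ω m < kHat f Q ω (m + δ) :=
        h.k_strictMono ⟨hm.1.le, hm.2⟩ ⟨by linarith [hm.1], hδm⟩ (by linarith)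
      refine lt_of_le_of_lt ?_ h1
      rw [← Real.sq_sqrt (h.kHat_pos hm).le]
      have := hl.1
      gcongr
      exact hl.2
    set κ := √(kHat f Q ω (m + δ) - l ^ 2)
    -- From M + 2ηκx ≤ (1 + 2η²)M one divides by 2η. The gain is of first order in η and the loss of
    -- second order, so η → 0 forces x = 0.
    have hle : ∀ η, 0 < η → κ * x ≤ 0 + η * M := by
      intro η hη
      have h1 := (ofReal_div_le_scG h hm hl hp hul hur w hw hδ.le hδm hη.le hSδ v).trans hv
      rw [ENNReal.ofReal_le_ofReal_iff hM, div_le_iff₀ (by positivity)] at h1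
      have : η * (κ * x) ≤ η * (η * M) := by nlinarith
      linarith [le_of_mul_le_mul_left this hη]
    have hle0 : κ * x ≤ 0 := by
      have hlim : Tendsto (fun η : ℝ => 0 + η * M) (𝓝[>] 0) (𝓝 (0 + 0 * M)) :=
        tendsto_nhdsWithin_of_tendsto_nhds (Continuous.tendsto (by fun_prop) 0)
      have := ge_of_tendsto hlim (eventually_nhdsWithin_of_forall fun η hη => hle η hη)
      simpa using this
    have hx0 : x ≤ 0 := by
      by_contra hc
      push Not at hc
      exact absurd hle0 (not_le.2 (mul_pos hκ hc))
    have : |(∫ t in S, v t ∂volume.restrict (Ioo (2 * m - 1) 1)) -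
          ∫ t in S, w t ∂volume.restrict (Ioo (2 * m - 1) 1)| ≤ 0 := by
      rw [hx, div_le_iff₀ hm2, zero_mul] at hx0
      exact hx0
    linarith [abs_eq_zero.1 (le_antisymm this (abs_nonneg _))]
  have hae : ∀ δ, 0 < δ → m + δ < 1 →
      ∀ᵐ t ∂volume.restrict (Ioo (2 * m - 1) 1), δ < |t - m| → v t = w t := by
    intro δ hδ hδm
    have hE : MeasurableSet {x : ℝ | δ < |x - m|} :=
      measurableSet_lt measurable_const (by fun_prop)
    refine (ae_restrict_iff' (p := fun t => v t = w t) hE).1 ?_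
    refine Integrable.ae_eq_of_forall_setIntegral_eq _ _ (hint v).integrableOn
      (hint w).integrableOn fun S hS _ => ?_
    rw [Measure.restrict_restrict hS]
    exact hset δ hδ hδm _ inter_subset_right
  -- Countably many δ exhaust the complement of m. The denominator `n + 2` makes m + δ < 1 already
  -- at `n = 0`.
  have hall : ∀ᵐ t ∂volume.restrict (Ioo (2 * m - 1) 1),
      ∀ n : ℕ, (1 - m) / (n + 2) < |t - m| → v t = w t := by
    rw [ae_all_iff]
    intro n
    have hn : (0 : ℝ) < n + 2 := by positivity
    have h1m : 0 < 1 - m := by linarith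
    refine hae _ (by positivity) ?_
    have : (1 - m) / (n + 2) < 1 - m := by
      rw [div_lt_iff₀ hn]
      nlinarith [(Nat.cast_nonneg n : (0 : ℝ) ≤ n)]
    linarith
  refine Lp.ext ?_
  filter_upwards [hall, ae_restrict_mem_and_ne m] with t h1 ⟨_, h2⟩
  obtain ⟨n, hn⟩ := exists_nat_gt ((1 - m) / |t - m|)
  have hpos : 0 < |t - m| := abs_pos.2 (sub_ne_zero.2 h2)
  refine h1 n ?_
  rw [div_lt_iff₀ hpos] at hn
  rw [div_lt_iff₀ (by positivity)]
  nlinarith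

end LowerBound

/-! ### The candidate and the upper bound -/

/-- A lower semicontinuous minorant of `F` is bounded at the limit by the limiting energy of any
approximating sequence, so one recovery sequence bounds the envelope from above. -/
lemma lscEnvelope_le_of_tendsto {X : Type*} [TopologicalSpace X] {F : X → ℝ≥0∞} {y : ℕ → X} {x : X}
    {e : ℕ → ℝ≥0∞} {T : ℝ≥0∞} (hy : Tendsto y atTop (𝓝 x)) (hF : ∀ n, F (y n) ≤ e n)
    (he : Tendsto e atTop (𝓝 T)) : lscEnvelope F x ≤ T := by
  refine iSup_le fun ⟨H, hH, hle⟩ => le_of_forall_lt_imp_le_of_dense fun c hc => ?_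
  refine ge_of_tendsto he ?_
  filter_upwards [hy.eventually (hH x c hc)] with n hn
  exact hn.le.trans ((hle _).trans (hF n))

variable {f Q ω g p : ℝ → ℝ} {m s l δ J t : ℝ}

/-- The odd (about `m`, up to the constant `s / 2`) primitive of `p`, with a jump `J` at `m`. -/
noncomputable def jumpPrimitive (p : ℝ → ℝ) (m s J t : ℝ) : ℝ :=
  s / 2 + (∫ x in m..t, p x) + J / 2 * (SignType.sign (t - m) : ℝ)

lemma mem_Icc_of_lt_one (hm : m < 1) : m ∈ Icc (2 * m - 1) 1 := ⟨by linarith, hm.le⟩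

lemma integral_reflect (hpe : ∀ t, p (2 * m - t) = p t) (t : ℝ) :
    ∫ x in m..(2 * m - t), p x = -∫ x in m..t, p x := by
  have := intervalIntegral.integral_comp_sub_left (a := m) (b := t) p (2 * m)
  simp only [hpe] at this
  rw [this, intervalIntegral.integral_symm (2 * m - t)]
  ring_nf

lemma integral_half_eq (hm : m < 1) (hpe : ∀ t, p (2 * m - t) = p t)
    (hp : IntegrableOn p (Ioo (2 * m - 1) 1)) :
    ∫ x in m..1, p x = (∫ x in Ioo (2 * m - 1) 1, p x) / 2 := by
  have hmI := mem_Icc_of_lt_one hm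
  have hab : 2 * m - 1 ≤ 1 := by linarith
  rw [← intervalIntegral_eq_setIntegral_Ioo hab, ← intervalIntegral.integral_add_adjacent_intervals
    (intervalIntegrable_of_integrableOn_Ioo hp (left_mem_Icc.2 hab) hmI)
    (intervalIntegrable_of_integrableOn_Ioo hp hmI (right_mem_Icc.2 hab)),
    intervalIntegral.integral_symm m, integral_reflect hpe]
  ring

section JumpPrimitive

lemma jumpPrimitive_reflect (hpe : ∀ t, p (2 * m - t) = p t) :
    jumpPrimitive p m s J (2 * m - t) - s / 2 = -(jumpPrimitive p m s J t - s / 2) := by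
  rw [jumpPrimitive, jumpPrimitive, integral_reflect hpe, show 2 * m - t - m = -(t - m) by ring,
    Left.sign_neg]
  push_cast
  ring

lemma jumpPrimitive_self : jumpPrimitive p m s J m = s / 2 := by simp [jumpPrimitive]

lemma jumpPrimitive_of_lt (ht : m < t) :
    jumpPrimitive p m s J t = s / 2 + J / 2 + ∫ x in m..t, p x := by
  rw [jumpPrimitive, sign_pos (sub_pos.2 ht)]
  simp only [SignType.coe_one]
  ring

lemma jumpPrimitive_of_gt (ht : t < m) :
    jumpPrimitive p m s J t = s / 2 - J / 2 + ∫ x in m..t, p x := by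
  rw [jumpPrimitive, sign_neg (sub_neg.2 ht)]
  simp only [SignType.coe_neg, SignType.coe_one]
  ring

variable (hm : m < 1) (hpe : ∀ t, p (2 * m - t) = p t)
  (hp : IntegrableOn p (Ioo (2 * m - 1) 1)) (hJ : (∫ x in Ioo (2 * m - 1) 1, p x) + J = s)

include hm hpe hp hJ

lemma jumpPrimitive_one : jumpPrimitive p m s J 1 = s := by
  rw [jumpPrimitive_of_lt hm, integral_half_eq hm hpe hp]
  linarith

lemma jumpPrimitive_left : jumpPrimitive p m s J (2 * m - 1) = 0 := by
  have := jumpPrimitive_reflect (p := p) (m := m) (s := s) (J := J) (t := 1) hpe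
  rw [jumpPrimitive_one hm hpe hp hJ] at this
  linarith

lemma jumpPrimitive_eq_of_lt (ht : t ∈ Ioo m 1) :
    jumpPrimitive p m s J t = s - ∫ x in t..1, p x := by
  have htI : t ∈ Icc (2 * m - 1) 1 := ⟨by linarith [ht.1], ht.2.le⟩
  have h1 := jumpPrimitive_one hm hpe hp hJ
  rw [jumpPrimitive_of_lt hm, ← intervalIntegral.integral_add_adjacent_intervals
    (intervalIntegrable_of_integrableOn_Ioo hp (mem_Icc_of_lt_one hm) htI)
    (intervalIntegrable_of_integrableOn_Ioo hp htI ⟨by linarith, le_rfl⟩)] at h1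
  rw [jumpPrimitive_of_lt ht.1]
  linarith

lemma jumpPrimitive_eq_of_gt (ht : t ∈ Ioo (2 * m - 1) m) :
    jumpPrimitive p m s J t = ∫ x in (2 * m - 1)..t, p x := by
  have htI : t ∈ Icc (2 * m - 1) 1 := ⟨ht.1.le, by linarith [ht.2]⟩
  have h1 := jumpPrimitive_left hm hpe hp hJ
  rw [jumpPrimitive_of_gt (by linarith)] at h1
  rw [jumpPrimitive_of_gt ht.2, ← intervalIntegral.integral_add_adjacent_intervals
    (intervalIntegrable_of_integrableOn_Ioo hp (mem_Icc_of_lt_one hm) ⟨le_rfl, by linarith⟩)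
    (intervalIntegrable_of_integrableOn_Ioo hp ⟨le_rfl, by linarith⟩ htI)]
  linarith

end JumpPrimitive

lemma jumpPrimitive_zero_eq (p : ℝ → ℝ) (m s : ℝ) :
    jumpPrimitive p m s 0 = fun t => s / 2 + ∫ x in m..t, p x := by
  ext t
  simp [jumpPrimitive]

lemma monotone_coe_sign_sub (m : ℝ) : Monotone fun t : ℝ => (SignType.sign (t - m) : ℝ) := by
  intro x y hxy
  have hle : ∀ a b : SignType, a ≤ b → (a : ℤ) ≤ b := by decide
  dsimp only
  rw [← SignType.intCast_cast, ← SignType.intCast_cast (SignType.sign (y - m))]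
  exact_mod_cast hle _ _ (SignType.sign.monotone (sub_le_sub_right hxy m))

lemma jumpPrimitive_integrable (hm : m < 1) (hp : IntegrableOn p (Ioo (2 * m - 1) 1)) :
    IntegrableOn (jumpPrimitive p m s J) (Ioo (2 * m - 1) 1) := by
  refine ((integrableOn_const (by simp)).add
    (integrableOn_primitive hp (mem_Icc_of_lt_one hm))).add ?_
  refine Integrable.const_mul ?_ _
  exact ((monotone_coe_sign_sub m).locallyIntegrable.integrableOn_isCompact isCompact_Icc).mono_set
    Ioo_subset_Icc_self

lemma hasWeakDeriv_zeta (hm : m < 1) (s : ℝ) :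
    HasWeakDeriv (2 * m - 1) 1 (zeta m s) fun _ => s / (2 * (1 - m)) := by
  have := hasWeakDeriv_primitive_add_const (a := 2 * m - 1) (b := 1) (c := 2 * m - 1)
    (g := fun _ => s / (2 * (1 - m))) (integrableOn_const (by simp)) ⟨le_rfl, by linarith⟩ 0
  refine this.congr_ae (Eventually.of_forall fun t => ?_)
  simp only [intervalIntegral.integral_const, zeta, smul_eq_mul]
  ring

/-- The energy of a continuous competitor. -/
lemma GFunDirichlet_le (hm : m < 1) (hge : ∀ t, g (2 * m - t) = g t)
    (hg : IntegrableOn g (Ioo (2 * m - 1) 1)) (hgs : ∫ x in Ioo (2 * m - 1) 1, g x = s)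
    {y : L1 m} (hy : jumpPrimitive g m s 0 =ᵐ[volume.restrict (Ioo (2 * m - 1) 1)] y) :
    GFunDirichlet f Q ω m s y ≤ ∫⁻ t in Ioo (2 * m - 1) 1,
      ENNReal.ofReal √(kEven f Q ω m t * |g t| ^ 2 + omegaEven ω m t) := by
  have hmI := mem_Icc_of_lt_one hm
  have hJ : (∫ x in Ioo (2 * m - 1) 1, g x) + 0 = s := by rw [hgs, add_zero]
  have hw : HasWeakDeriv (2 * m - 1) 1 y g := by
    refine HasWeakDeriv.congr_ae ?_ hy
    rw [jumpPrimitive_zero_eq]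
    exact hasWeakDeriv_primitive_add_const hg hmI _
  have hmem : MemW11Zero (2 * m - 1) 1 (fun t => y t - zeta m s t) := by
    refine ⟨⟨_, hw.sub (hasWeakDeriv_zeta hm s)⟩,
      fun t => jumpPrimitive g m s 0 t - zeta m s t, ?_, ?_, ?_, ?_⟩
    · rw [jumpPrimitive_zero_eq]
      exact (continuousOn_const.add (continuousOn_primitive hg hmI)).sub
        (continuous_zeta m s).continuousOn
    · filter_upwards [hy] with t ht
      rw [ht]
    · simp only [jumpPrimitive_left hm hge hg hJ, zeta_left, sub_zero]
    · simp only [jumpPrimitive_one hm hge hg hJ, zeta_right hm, sub_self]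
  rw [GFunDirichlet, if_pos hmem]
  exact iInf₂_le g hw

/-- The derivative of the piecewise affine ramp of height `J` supported in `[m - δ, m + δ]`. -/
noncomputable def ramp (m δ J : ℝ) : ℝ → ℝ := (Icc (m - δ) (m + δ)).indicator fun _ => J / (2 * δ)

lemma ramp_reflect : ramp m δ J (2 * m - t) = ramp m δ J t := by
  have : 2 * m - t ∈ Icc (m - δ) (m + δ) ↔ t ∈ Icc (m - δ) (m + δ) := by
    rw [mem_Icc, mem_Icc]
    constructor <;> rintro ⟨_, _⟩ <;> constructor <;> linarith
  simp only [ramp, indicator, this]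

lemma ramp_integrable (m δ J : ℝ) {S : Set ℝ} : IntegrableOn (ramp m δ J) S :=
  (IntegrableOn.integrable_indicator (integrableOn_const (by simp)) measurableSet_Icc).integrableOn

lemma ramp_nonneg (hδ : 0 < δ) (hJ : 0 ≤ J) (t : ℝ) : 0 ≤ ramp m δ J t :=
  indicator_nonneg (fun _ _ => by positivity) t

lemma integral_ramp_of_le (hδ : 0 < δ) (ht : m + δ ≤ t) : ∫ x in m..t, ramp m δ J x = J / 2 := by
  rw [ramp, intervalIntegral.integral_of_le (by linarith), integral_indicator measurableSet_Icc,
    Measure.restrict_restrict measurableSet_Icc]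
  have : Icc (m - δ) (m + δ) ∩ Ioc m t = Ioc m (m + δ) := by
    ext x
    simp only [mem_inter_iff, mem_Icc, mem_Ioc]
    constructor
    · rintro ⟨⟨_, _⟩, _, _⟩
      constructor <;> linarith
    · rintro ⟨_, _⟩
      refine ⟨⟨?_, ?_⟩, ?_, ?_⟩ <;> linarith
  rw [this, setIntegral_const, Real.volume_real_Ioc_of_le (by linarith), smul_eq_mul]
  field_simp
  ring

lemma integral_ramp_mem_Icc (hδ : 0 < δ) (hJ : 0 ≤ J) (ht : m ≤ t) :
    ∫ x in m..t, ramp m δ J x ∈ Icc 0 (J / 2) := by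
  refine ⟨intervalIntegral.integral_nonneg ht fun x _ => ramp_nonneg hδ hJ x, ?_⟩
  rcases le_total (m + δ) t with h1 | h1
  · exact (integral_ramp_of_le hδ h1).le
  · rw [← integral_ramp_of_le (m := m) (t := m + δ) (J := J) hδ le_rfl]
    exact intervalIntegral.integral_mono_interval le_rfl ht h1
      (ae_of_all _ fun x => ramp_nonneg hδ hJ x)
      ((ramp_integrable m δ J).intervalIntegrable (a := m) (b := m + δ))

/-- The integrated ramp and its limiting step differ only on [m − δ, m + δ], by at most J/2. This
gives the L¹ convergence of the recovery sequence. -/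
lemma abs_integral_ramp_sub_le (hδ : 0 < δ) (hJ : 0 ≤ J) (t : ℝ) :
    |(∫ x in m..t, ramp m δ J x) - J / 2 * (SignType.sign (t - m) : ℝ)| ≤
      (Icc (m - δ) (m + δ)).indicator (fun _ => J / 2) t := by
  -- Both the integrated ramp and the sign function are odd about m.
  wlog ht : m ≤ t generalizing t with H
  · have := H (2 * m - t) (by linarith)
    rw [integral_reflect fun t => ramp_reflect, show 2 * m - t - m = -(t - m) by ring,
      Left.sign_neg, ← abs_neg] at this
    have e : (Icc (m - δ) (m + δ)).indicator (fun _ => J / 2) (2 * m - t) =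
        (Icc (m - δ) (m + δ)).indicator (fun _ => J / 2) t := by
      have : 2 * m - t ∈ Icc (m - δ) (m + δ) ↔ t ∈ Icc (m - δ) (m + δ) := by
        rw [mem_Icc, mem_Icc]
        constructor <;> rintro ⟨_, _⟩ <;> constructor <;> linarith
      simp only [indicator, this]
    rw [e] at this
    refine le_trans (le_of_eq ?_) this
    push_cast
    ring_nf
  rcases ht.eq_or_lt with rfl | ht
  · simp only [intervalIntegral.integral_same, sub_self, sign_zero, SignType.coe_zero, mul_zero,
      abs_zero]
    exact indicator_nonneg (fun _ _ => by positivity) _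
  rw [sign_pos (sub_pos.2 ht), SignType.coe_one, mul_one]
  by_cases h1 : t ≤ m + δ
  · rw [indicator_of_mem (show t ∈ Icc (m - δ) (m + δ) from ⟨by linarith, h1⟩)]
    have := integral_ramp_mem_Icc (m := m) hδ hJ ht.le
    exact abs_le.2 ⟨by linarith [this.1], by linarith [this.2]⟩
  · rw [integral_ramp_of_le hδ (by linarith), sub_self, abs_zero]
    exact indicator_nonneg (fun _ _ => by positivity) _

lemma integral_ramp (hm : m < 1) (hδ : 0 < δ) (hδm : m + δ ≤ 1) :
    ∫ x in Ioo (2 * m - 1) 1, ramp m δ J x = J := by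
  have := integral_half_eq hm (fun t => ramp_reflect) (ramp_integrable m δ J)
  rw [integral_ramp_of_le hδ hδm] at this
  linarith

section UpperBound

variable (h : Hypotheses f Q ω) (hm : m ∈ Ioo (0 : ℝ) 1)

include h hm

/-- The Lipschitz constant √k̂_m is at most √k̂(m + δ) on the support of the ramp, and the ramp has
total mass J. -/
lemma energy_add_ramp_le (hδ : 0 < δ) (hδm : m + δ < 1) (hJ : 0 ≤ J)
    (hp : AEMeasurable p (volume.restrict (Ioo (2 * m - 1) 1))) :
    ∫⁻ t in Ioo (2 * m - 1) 1, ENNReal.ofReal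
        √(kEven f Q ω m t * |p t + ramp m δ J t| ^ 2 + omegaEven ω m t) ≤
      (∫⁻ t in Ioo (2 * m - 1) 1, ENNReal.ofReal
        √(kEven f Q ω m t * |p t| ^ 2 + omegaEven ω m t)) +
        ENNReal.ofReal (√(kHat f Q ω (m + δ)) * J) := by
  have hK := kEven_aemeasurable h hm
  have hW := omegaEven_aemeasurable h hm
  have e : ENNReal.ofReal (√(kHat f Q ω (m + δ)) * J) = ∫⁻ t in Ioo (2 * m - 1) 1,
      ENNReal.ofReal (√(kHat f Q ω (m + δ)) * ramp m δ J t) := by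
    rw [← ofReal_integral_eq_lintegral_ofReal ((ramp_integrable m δ J).const_mul _)
      (ae_of_all _ fun t => mul_nonneg (Real.sqrt_nonneg _) (ramp_nonneg hδ hJ t)),
      integral_const_mul, integral_ramp hm.2 hδ hδm.le]
  rw [e, ← lintegral_add_left' (by fun_prop)]
  refine lintegral_mono_ae ?_
  filter_upwards [ae_restrict_mem measurableSet_Ioo] with t ht
  have hr := ramp_nonneg (m := m) hδ hJ t
  rw [← ENNReal.ofReal_add (Real.sqrt_nonneg _) (by positivity)]
  refine ENNReal.ofReal_le_ofReal ((sqrt_add_le_sqrt_add_mul (kEven_pos h hm ht).le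
    (omegaEven_pos h hm ht).le hr).trans (add_le_add_right ?_ _))
  by_cases h1 : t ∈ Icc (m - δ) (m + δ)
  · gcongr
    exact kEven_le_kHat h hm hδm (by
      have : |t - m| ≤ δ := abs_le.2 ⟨by linarith [h1.1], by linarith [h1.2]⟩
      linarith)
  · rw [ramp, indicator_of_notMem h1, mul_zero, mul_zero]

/-- The upper bound for the relaxed energy of the candidate. -/
lemma scG_jumpPrimitive_le (hJ0 : 0 ≤ J) (hpe : ∀ t, p (2 * m - t) = p t)
    (hp : IntegrableOn p (Ioo (2 * m - 1) 1)) (hJ : (∫ x in Ioo (2 * m - 1) 1, p x) + J = s)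
    {w : L1 m} (hw : jumpPrimitive p m s J =ᵐ[volume.restrict (Ioo (2 * m - 1) 1)] w) :
    scG f Q ω m s w ≤ (∫⁻ t in Ioo (2 * m - 1) 1, ENNReal.ofReal
        √(kEven f Q ω m t * |p t| ^ 2 + omegaEven ω m t)) +
        ENNReal.ofReal (√(kHat f Q ω m) * J) := by
  have h1m : 0 < 1 - m := by linarith [hm.2]
  have hδ : ∀ n : ℕ, 0 < (1 - m) / (n + 2) := fun n => by positivity
  have hδm : ∀ n : ℕ, m + (1 - m) / (n + 2) < 1 := fun n => by
    have : (1 - m) / (n + 2) < 1 - m := by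
      rw [div_lt_iff₀ (by positivity)]
      nlinarith [(Nat.cast_nonneg n : (0 : ℝ) ≤ n)]
    linarith
  have hlim : Tendsto (fun n : ℕ => (1 - m) / ((n : ℝ) + 2)) atTop (𝓝 0) :=
    tendsto_const_nhds.div_atTop (tendsto_atTop_add_const_right _ _ tendsto_natCast_atTop_atTop)
  have hge : ∀ n : ℕ, ∀ t, p (2 * m - t) + ramp m ((1 - m) / (n + 2)) J (2 * m - t) =
      p t + ramp m ((1 - m) / (n + 2)) J t := fun n t => by rw [hpe, ramp_reflect]
  have hg : ∀ n : ℕ, IntegrableOn (fun t => p t + ramp m ((1 - m) / (n + 2)) J t)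
      (Ioo (2 * m - 1) 1) := fun n => hp.add (ramp_integrable _ _ _)
  have hgs : ∀ n : ℕ, ∫ t in Ioo (2 * m - 1) 1, p t + ramp m ((1 - m) / (n + 2)) J t = s :=
    fun n => by rw [integral_add hp (ramp_integrable _ _ _), integral_ramp hm.2 (hδ n) (hδm n).le, hJ]
  have hL : ∀ n : ℕ, MemLp (jumpPrimitive (fun t => p t + ramp m ((1 - m) / (n + 2)) J t) m s 0) 1
      (volume.restrict (Ioo (2 * m - 1) 1)) := fun n =>
    memLp_one_iff_integrable.2 (jumpPrimitive_integrable hm.2 (hg n))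
  have hu : MemLp (jumpPrimitive p m s J) 1 (volume.restrict (Ioo (2 * m - 1) 1)) :=
    memLp_one_iff_integrable.2 (jumpPrimitive_integrable hm.2 hp)
  have hwu : w = hu.toLp _ := Lp.ext (hw.symm.trans hu.coeFn_toLp.symm)
  -- The recovery sequence replaces the jump by ramps of half-width (1 − m)/(n + 2); continuity of
  -- k̂ at m brings the cost of the ramps down to √k̂(m)·J.
  refine lscEnvelope_le_of_tendsto (y := fun n => (hL n).toLp _)
    (e := fun n => (∫⁻ t in Ioo (2 * m - 1) 1, ENNReal.ofReal
        √(kEven f Q ω m t * |p t| ^ 2 + omegaEven ω m t)) +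
        ENNReal.ofReal (√(kHat f Q ω (m + (1 - m) / (n + 2))) * J)) ?_ (fun n => ?_) ?_
  · rw [hwu, tendsto_iff_edist_tendsto_0]
    have hz : Tendsto (fun n : ℕ => ENNReal.ofReal (J / 2) *
        ENNReal.ofReal (2 * ((1 - m) / ((n : ℝ) + 2)))) atTop (𝓝 0) := by
      have := ENNReal.Tendsto.const_mul (a := ENNReal.ofReal (J / 2))
        (ENNReal.tendsto_ofReal (hlim.const_mul 2)) (Or.inr ENNReal.ofReal_ne_top)
      simpa using this
    refine tendsto_of_tendsto_of_tendsto_of_le_of_le tendsto_const_nhds hz (fun _ => zero_le)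
      fun n => ?_
    simp only [Lp.edist_toLp_toLp, eLpNorm_one_eq_lintegral_enorm]
    calc _ ≤ ∫⁻ t in Ioo (2 * m - 1) 1, (Icc (m - (1 - m) / (n + 2)) (m + (1 - m) / (n + 2))).indicator
          (fun _ => ENNReal.ofReal (J / 2)) t := by
          refine lintegral_mono_ae ?_
          filter_upwards [ae_restrict_mem measurableSet_Ioo] with t ht
          have hb := abs_integral_ramp_sub_le (m := m) (hδ n) hJ0 t
          have ht' : t ∈ Icc (2 * m - 1) 1 := Ioo_subset_Icc_self ht
          have e : jumpPrimitive (fun t => p t + ramp m ((1 - m) / (n + 2)) J t) m s 0 t -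
              jumpPrimitive p m s J t = (∫ x in m..t, ramp m ((1 - m) / (n + 2)) J x) -
                J / 2 * (SignType.sign (t - m) : ℝ) := by
            simp only [jumpPrimitive]
            rw [intervalIntegral.integral_add
              (intervalIntegrable_of_integrableOn_Ioo hp (mem_Icc_of_lt_one hm.2) ht')
              (ramp_integrable _ _ _).intervalIntegrable]
            ring
          rw [Pi.sub_apply, e, Real.enorm_eq_ofReal_abs]
          refine (ENNReal.ofReal_le_ofReal hb).trans (le_of_eq ?_)
          simp only [indicator]
          split_ifs <;> simp
      _ ≤ ∫⁻ t, (Icc (m - (1 - m) / (n + 2)) (m + (1 - m) / (n + 2))).indicator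
          (fun _ => ENNReal.ofReal (J / 2)) t := lintegral_mono' Measure.restrict_le_self le_rfl
      _ = ENNReal.ofReal (J / 2) * ENNReal.ofReal (2 * ((1 - m) / (n + 2))) := by
          rw [lintegral_indicator measurableSet_Icc, setLIntegral_const, Real.volume_Icc]
          congr 2
          ring
  · exact (GFunDirichlet_le hm.2 (hge n) (hg n) (hgs n) (hL n).coeFn_toLp.symm).trans
      (energy_add_ramp_le h hm (hδ n) (hδm n) hJ0 hp.aemeasurable)
  · refine Tendsto.const_add _ (ENNReal.tendsto_ofReal (Tendsto.mul_const _ ?_))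
    have hc : ContinuousAt (kHat f Q ω) m :=
      h.kHat_continuousOn.continuousAt (Ico_mem_nhds hm.1 hm.2)
    have := hlim.const_add m
    rw [add_zero] at this
    exact (hc.tendsto.comp this).sqrt

end UpperBound

/-! ### The distributional derivative of the candidate -/

/-- The signed measure `J δ_m`. -/
noncomputable def diracJordan (m : ℝ) (J : NNReal) : JordanDecomposition ℝ :=
  J • ⟨Measure.dirac m, 0, Measure.MutuallySingular.zero_right⟩

/-- As the measure is given by a Jordan decomposition, the positive and negative parts required in
`HasBVDeriv` can be read off. -/
lemma diracJordan_posPart (m : ℝ) (J : NNReal) :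
    (diracJordan m J).toSignedMeasure.toJordanDecomposition.posPart = J • Measure.dirac m := by
  rw [JordanDecomposition.toJordanDecomposition_toSignedMeasure, diracJordan,
    JordanDecomposition.smul_posPart]

lemma diracJordan_negPart (m : ℝ) (J : NNReal) :
    (diracJordan m J).toSignedMeasure.toJordanDecomposition.negPart = 0 := by
  rw [JordanDecomposition.toJordanDecomposition_toSignedMeasure, diracJordan,
    JordanDecomposition.smul_negPart, smul_zero]

lemma diracJordan_totalVariation (m : ℝ) (J : NNReal) :
    (diracJordan m J).toSignedMeasure.totalVariation = J • Measure.dirac m := by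
  rw [SignedMeasure.totalVariation, diracJordan_posPart, diracJordan_negPart, add_zero]

lemma jumpPrimitive_integral_mul_deriv (hm : m < 1) (hp : IntegrableOn p (Ioo (2 * m - 1) 1))
    {φ : ℝ → ℝ} (hφ : IsTestFunction (2 * m - 1) 1 φ) :
    ∫ x in Ioo (2 * m - 1) 1, jumpPrimitive p m s J x * deriv φ x =
      -((∫ x in Ioo (2 * m - 1) 1, p x * φ x) + J * φ m) := by
  have hmI := mem_Icc_of_lt_one hm
  have h1 := jumpPrimitive_integrable (s := s) (J := 0) hm hp
  have h2 : IntegrableOn (fun t => J / 2 * (SignType.sign (t - m) : ℝ)) (Ioo (2 * m - 1) 1) := by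
    have := (jumpPrimitive_integrable (s := s) (J := J) hm hp).sub h1
    refine this.congr (ae_of_all _ fun t => ?_)
    simp [jumpPrimitive]
  have e : ∀ x, jumpPrimitive p m s J x * deriv φ x =
      jumpPrimitive p m s 0 x * deriv φ x + J / 2 * (SignType.sign (x - m) : ℝ) * deriv φ x :=
    fun x => by simp only [jumpPrimitive]; ring
  simp_rw [e]
  rw [integral_add (hφ.integrableOn_mul_deriv h1) (hφ.integrableOn_mul_deriv h2)]
  simp_rw [mul_assoc]
  rw [integral_const_mul, integral_sign_mul_deriv ⟨by linarith, hm⟩ hφ, jumpPrimitive_zero_eq,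
    (hasWeakDeriv_primitive_add_const hp hmI (s / 2)).2.2 φ hφ]
  ring

lemma jumpPrimitive_hasBVDeriv (hm : m < 1) (hp : IntegrableOn p (Ioo (2 * m - 1) 1)) (hJ : 0 ≤ J)
    {w : ℝ → ℝ} (hw : jumpPrimitive p m s J =ᵐ[volume.restrict (Ioo (2 * m - 1) 1)] w) :
    HasBVDeriv (2 * m - 1) 1 w p (diracJordan m J.toNNReal).toSignedMeasure := by
  have hmI : m ∈ Ioo (2 * m - 1) 1 := ⟨by linarith, hm⟩
  refine ⟨(jumpPrimitive_integrable hm hp).congr hw, hp, ?_, ?_, fun φ hφ => ?_⟩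
  · rw [diracJordan_totalVariation]
    simp [hmI.1, hmI.2]
  · rw [diracJordan_totalVariation]
    exact (mutuallySingular_dirac m volume).smul _
  · rw [diracJordan_posPart, diracJordan_negPart, integral_zero_measure, sub_zero,
      integral_smul_nnreal_measure, integral_dirac, NNReal.smul_def, Real.coe_toNNReal J hJ,
      smul_eq_mul, ← jumpPrimitive_integral_mul_deriv (s := s) hm hp hφ]
    refine integral_congr_ae ?_
    filter_upwards [hw] with t ht
    rw [ht]

/-- The candidate is a Sobolev function if and only if there is no jump. -/
lemma memW11_jumpPrimitive_iff (hm : m < 1) (hp : IntegrableOn p (Ioo (2 * m - 1) 1))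
    {w : ℝ → ℝ} (hw : jumpPrimitive p m s J =ᵐ[volume.restrict (Ioo (2 * m - 1) 1)] w) :
    MemW11 (2 * m - 1) 1 w ↔ J = 0 := by
  have hmI : m ∈ Ioo (2 * m - 1) 1 := ⟨by linarith, hm⟩
  constructor
  · rintro ⟨g, hwg⟩
    obtain ⟨-, hg, hwg⟩ := hwg.congr_ae hw.symm
    have key : ∀ φ, IsTestFunction (2 * m - 1) 1 φ →
        ∫ x in Ioo (2 * m - 1) 1, (g x - p x) * φ x = J * φ m := fun φ hφ => by
      have := hwg φ hφ
      rw [jumpPrimitive_integral_mul_deriv hm hp hφ] at this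
      simp_rw [sub_mul]
      rw [integral_sub (hφ.integrableOn_mul hg) (hφ.integrableOn_mul hp)]
      linarith
    have hU : IsOpen (Ioo (2 * m - 1) 1 \ {m}) := isOpen_Ioo.sdiff isClosed_singleton
    -- Test functions supported away from m do not see the jump, so any weak derivative `g` equals
    -- `p` a.e.
    have hae : ∀ᵐ x, x ∈ Ioo (2 * m - 1) 1 \ {m} → g x - p x = 0 := by
      refine hU.ae_eq_zero_of_integral_contDiff_smul_eq_zero
        (((hg.sub hp).mono_set sdiff_subset).locallyIntegrableOn) fun φ h1 h2 h3 => ?_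
      have hφ : IsTestFunction (2 * m - 1) 1 φ := ⟨h1, h2, h3.trans sdiff_subset⟩
      have hφm : φ m = 0 := image_eq_zero_of_notMem_tsupport fun hx => (h3 hx).2 rfl
      have := key φ hφ
      rw [hφm, mul_zero] at this
      rw [← this, setIntegral_eq_integral_of_forall_compl_eq_zero
        fun x hx => by rw [hφ.eq_zero_of_notMem hx, mul_zero]]
      simp only [smul_eq_mul, mul_comm]
    -- A bump with value 1 at m now yields J = 0, since the integral on the other side vanishes.
    let β : ContDiffBump m := ⟨(1 - m) / 4, (1 - m) / 2, by linarith, by linarith⟩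
    have hβ : IsTestFunction (2 * m - 1) 1 β := by
      refine ⟨β.contDiff, β.hasCompactSupport, ?_⟩
      rw [β.tsupport_eq, Real.closedBall_eq_Icc]
      exact Icc_subset_Ioo (by simp only [β]; linarith) (by simp only [β]; linarith)
    have hβm : β m = 1 := β.one_of_mem_closedBall (Metric.mem_closedBall_self β.rIn_pos.le)
    have := key β hβ
    rw [hβm, mul_one] at this
    rw [← this]
    refine integral_eq_zero_of_ae ?_
    filter_upwards [ae_restrict_mem_and_ne m, ae_restrict_of_ae hae] with x hx hx'
    simp [hx' ⟨hx.1, hx.2⟩]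
  · rintro rfl
    refine ⟨p, HasWeakDeriv.congr_ae ?_ hw⟩
    rw [jumpPrimitive_zero_eq]
    exact hasWeakDeriv_primitive_add_const hp (mem_Icc_of_lt_one hm) _

/-! ### The choice of the multiplier -/

section Multiplier

variable {f Q ω : ℝ → ℝ} {m s l l' t : ℝ} (h : Hypotheses f Q ω) (hm : m ∈ Ioo (0 : ℝ) 1)

lemma BFun_eq_lintegral_slope (hm1 : m < 1) (l : ℝ) :
    BFun f Q ω m l = ∫⁻ t in Ioo (2 * m - 1) 1, ENNReal.ofReal (slope f Q ω m l t) := by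
  refine (lintegral_Ioo_eq_two_mul hm1 (fun t => by rw [slope_reflect]) fun t ht => ?_).symm
  rw [slope, kEven_eq ht.1.le, omegaEven_eq ht.1.le]

lemma AFun_eq_lintegral_dualDensity (hm1 : m < 1) (l : ℝ) :
    AFun f Q ω m l = ∫⁻ t in Ioo (2 * m - 1) 1, ENNReal.ofReal (dualDensity f Q ω m l t) := by
  refine (lintegral_Ioo_eq_two_mul hm1 (fun t => ?_) fun t ht => ?_).symm
  · rw [dualDensity, dualDensity, kEven_reflect, omegaEven_reflect]
  · rw [dualDensity, kEven_eq ht.1.le, omegaEven_eq ht.1.le]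

lemma slope_nonneg : 0 ≤ slope f Q ω m l t := Real.sqrt_nonneg _

lemma BFun_eq_ofReal_integral (hm1 : m < 1)
    (hp : IntegrableOn (slope f Q ω m l) (Ioo (2 * m - 1) 1)) :
    BFun f Q ω m l = ENNReal.ofReal (∫ t in Ioo (2 * m - 1) 1, slope f Q ω m l t) := by
  rw [BFun_eq_lintegral_slope hm1,
    ofReal_integral_eq_lintegral_ofReal hp (ae_of_all _ fun t => slope_nonneg)]

include h hm

lemma sqrt_kHat_pos : 0 < √(kHat f Q ω m) := Real.sqrt_pos.2 (h.kHat_pos hm)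

lemma slope_lt_slope (hl : 0 ≤ l) (hll : l < l') (hl' : l' ≤ √(kHat f Q ω m))
    (ht : t ∈ Ioo (2 * m - 1) 1) (htm : t ≠ m) : slope f Q ω m l t < slope f Q ω m l' t :=
  slope_strictMono (kEven_pos h hm ht) (omegaEven_pos h hm ht) hl hll
    (sq_lt_kEven h hm ⟨hl.trans hll.le, hl'⟩ ht htm)

lemma slope_le_slope (hl : 0 ≤ l) (hll : l ≤ l') (hl' : l' ≤ √(kHat f Q ω m))
    (ht : t ∈ Ioo (2 * m - 1) 1) (htm : t ≠ m) : slope f Q ω m l t ≤ slope f Q ω m l' t := by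
  rcases hll.eq_or_lt with rfl | hll
  · exact le_rfl
  · exact (slope_lt_slope h hm hl hll hl' ht htm).le

lemma slope_pos (hl : l ∈ Ioc 0 √(kHat f Q ω m)) (ht : t ∈ Ioo (2 * m - 1) 1) (htm : t ≠ m) :
    0 < slope f Q ω m l t :=
  (slope_nonneg (l := 0)).trans_lt (slope_lt_slope h hm le_rfl hl.1 hl.2 ht htm)

lemma BFun_mono (hl : 0 ≤ l) (hll : l ≤ l') (hl' : l' ≤ √(kHat f Q ω m)) :
    BFun f Q ω m l ≤ BFun f Q ω m l' := by
  rw [BFun_eq_lintegral_slope hm.2, BFun_eq_lintegral_slope hm.2]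
  refine lintegral_mono_ae ?_
  filter_upwards [ae_restrict_mem_and_ne m] with t ⟨ht, htm⟩
  exact ENNReal.ofReal_le_ofReal (slope_le_slope h hm hl hll hl' ht htm)

lemma slope_integrable_of_BFun_ne_top (hB : BFun f Q ω m l ≠ ⊤) :
    IntegrableOn (slope f Q ω m l) (Ioo (2 * m - 1) 1) := by
  rw [BFun_eq_lintegral_slope hm.2] at hB
  exact lintegral_ofReal_ne_top_iff_integrable (slope_aemeasurable h hm l).aestronglyMeasurable
    (ae_of_all _ fun t => slope_nonneg) |>.1 hB

lemma AFun_eq_ofReal_integral (l : ℝ) :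
    AFun f Q ω m l = ENNReal.ofReal (∫ t in Ioo (2 * m - 1) 1, dualDensity f Q ω m l t) := by
  rw [AFun_eq_lintegral_dualDensity hm.2,
    ofReal_integral_eq_lintegral_ofReal (dualDensity_integrable h hm l)
      (ae_of_all _ fun t => Real.sqrt_nonneg _)]

/-- For λ < √k̂(m) the denominator k̂_m − λ² stays above k̂(m) − λ² > 0; only the extreme multiplier
can make B infinite. -/
lemma slope_integrable_of_lt (hl : 0 ≤ l) (hlt : l < √(kHat f Q ω m)) :
    IntegrableOn (slope f Q ω m l) (Ioo (2 * m - 1) 1) := by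
  have hW : IntegrableOn (fun t => √(omegaEven ω m t / (kHat f Q ω m - l ^ 2)))
      (Ioo (2 * m - 1) 1) :=
    ((((omegaEven_continuousOn h hm).div_const _).sqrt).integrableOn_compact isCompact_Icc).mono_set
      Ioo_subset_Icc_self
  have hd : 0 < kHat f Q ω m - l ^ 2 := by
    rw [sub_pos, ← Real.sq_sqrt (h.kHat_pos hm).le]
    gcongr
  refine hW.mono' (slope_aemeasurable h hm l).aestronglyMeasurable ?_
  filter_upwards [ae_restrict_mem_and_ne m] with t ⟨ht, htm⟩
  rw [Real.norm_of_nonneg slope_nonneg, slope]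
  refine Real.sqrt_le_sqrt ?_
  have hK := kHat_lt_kEven h hm ht htm
  have hKp := kEven_pos h hm ht
  have hWp := omegaEven_pos h hm ht
  rw [mul_div_mul_comm]
  have h1 : l ^ 2 / kEven f Q ω m t ≤ 1 := (div_le_one hKp).2 (by linarith)
  calc l ^ 2 / kEven f Q ω m t * (omegaEven ω m t / (kEven f Q ω m t - l ^ 2))
      ≤ 1 * (omegaEven ω m t / (kHat f Q ω m - l ^ 2)) := by
        gcongr
        exact div_nonneg hWp.le (by linarith)
    _ = _ := one_mul _

lemma slope_continuousOn (ht : t ∈ Ioo (2 * m - 1) 1) (htm : t ≠ m) :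
    ContinuousOn (fun l => slope f Q ω m l t) (Icc 0 √(kHat f Q ω m)) := by
  unfold slope
  refine ContinuousOn.sqrt (ContinuousOn.div (by fun_prop) (by fun_prop) fun l hl => ?_)
  exact (mul_pos (kEven_pos h hm ht) (sub_pos.2 (sq_lt_kEven h hm hl ht htm))).ne'

/-- Monotone convergence along multipliers increasing to √k̂(m). As B may be infinite there, this
supplies a smaller endpoint with finite B for the intermediate value theorem. -/
lemma exists_lt_BFun (hB : ENNReal.ofReal s < BFun f Q ω m √(kHat f Q ω m)) :
    ∃ l, 0 ≤ l ∧ l < √(kHat f Q ω m) ∧ ENNReal.ofReal s < BFun f Q ω m l := by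
  have hΛ := sqrt_kHat_pos h hm
  set Λ := √(kHat f Q ω m) with hΛdef
  have hlim : Tendsto (fun n : ℕ => Λ - Λ / ((n : ℝ) + 2)) atTop (𝓝 Λ) := by
    have : Tendsto (fun n : ℕ => Λ / ((n : ℝ) + 2)) atTop (𝓝 0) :=
      tendsto_const_nhds.div_atTop (tendsto_atTop_add_const_right _ _ tendsto_natCast_atTop_atTop)
    simpa using this.const_sub Λ
  have hmem : ∀ n : ℕ, Λ - Λ / ((n : ℝ) + 2) ∈ Ico 0 Λ := fun n => by
    have h1 : 0 < Λ / ((n : ℝ) + 2) := by positivity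
    have h2 : Λ / ((n : ℝ) + 2) ≤ Λ :=
      div_le_self hΛ.le (by linarith [(Nat.cast_nonneg n : (0 : ℝ) ≤ n)])
    exact ⟨by linarith, by linarith⟩
  have hmono : Monotone fun n : ℕ => Λ - Λ / ((n : ℝ) + 2) := fun i j hij => by
    have : (i : ℝ) ≤ j := by exact_mod_cast hij
    dsimp only
    gcongr
  have htend : Tendsto (fun n : ℕ => BFun f Q ω m (Λ - Λ / ((n : ℝ) + 2))) atTop
      (𝓝 (BFun f Q ω m Λ)) := by
    simp only [BFun_eq_lintegral_slope hm.2]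
    refine lintegral_tendsto_of_tendsto_of_monotone
      (fun n => (slope_aemeasurable h hm _).ennreal_ofReal) ?_ ?_
    · filter_upwards [ae_restrict_mem_and_ne m] with t ⟨ht, htm⟩ i j hij
      exact ENNReal.ofReal_le_ofReal
        (slope_le_slope h hm (hmem i).1 (hmono hij) (hmem j).2.le ht htm)
    · filter_upwards [ae_restrict_mem_and_ne m] with t ⟨ht, htm⟩
      refine ENNReal.tendsto_ofReal ?_
      refine (slope_continuousOn h hm ht htm Λ ⟨hΛ.le, le_rfl⟩).tendsto.comp
        (tendsto_nhdsWithin_iff.2 ⟨hlim, Eventually.of_forall fun n => ?_⟩)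
      exact ⟨(hmem n).1, (hmem n).2.le⟩
  obtain ⟨n, hn⟩ := (htend.eventually (lt_mem_nhds hB)).exists
  exact ⟨_, (hmem n).1, (hmem n).2, hn⟩

/-- The multiplier: either `B(m, λ) = s`, or `B(m, k̂(m)^{1/2}) ≤ s` and `λ = k̂(m)^{1/2}`. -/
lemma exists_multiplier (hs : 0 < s) : ∃ l ∈ Ioc 0 √(kHat f Q ω m),
    BFun f Q ω m l ≤ ENNReal.ofReal s ∧
      (BFun f Q ω m l = ENNReal.ofReal s ∨ l = √(kHat f Q ω m)) := by
  rcases le_or_gt (BFun f Q ω m √(kHat f Q ω m)) (ENNReal.ofReal s) with hB | hB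
  · exact ⟨_, ⟨sqrt_kHat_pos h hm, le_rfl⟩, hB, Or.inr rfl⟩
  obtain ⟨l₁, h0, h1, hl₁⟩ := exists_lt_BFun h hm hB
  have hint := slope_integrable_of_lt h hm h0 h1
  -- Slopes increase with the multiplier, so the integrable slope at `l₁` dominates all those below
  -- it.
  have hcont : ContinuousOn (fun l => ∫ t in Ioo (2 * m - 1) 1, slope f Q ω m l t) (Icc 0 l₁) := by
    refine continuousOn_of_dominated (bound := slope f Q ω m l₁)
      (fun l _ => (slope_aemeasurable h hm l).aestronglyMeasurable) (fun l hl => ?_) hint ?_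
    · filter_upwards [ae_restrict_mem_and_ne m] with t ⟨ht, htm⟩
      rw [Real.norm_of_nonneg slope_nonneg]
      exact slope_le_slope h hm hl.1 hl.2 h1.le ht htm
    · filter_upwards [ae_restrict_mem_and_ne m] with t ⟨ht, htm⟩
      exact (slope_continuousOn h hm ht htm).mono (Icc_subset_Icc_right h1.le)
  have hzero : ∫ t in Ioo (2 * m - 1) 1, slope f Q ω m 0 t = 0 := by simp [slope]
  have hlt : s < ∫ t in Ioo (2 * m - 1) 1, slope f Q ω m l₁ t := by
    rw [BFun_eq_ofReal_integral hm.2 hint] at hl₁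
    exact (ENNReal.ofReal_lt_ofReal_iff_of_nonneg hs.le).1 hl₁
  obtain ⟨l, hl, hls⟩ := intermediate_value_Icc h0 hcont (by
    rw [hzero]
    exact ⟨hs.le, hlt.le⟩ :
      s ∈ Icc (∫ t in Ioo (2 * m - 1) 1, slope f Q ω m 0 t)
        (∫ t in Ioo (2 * m - 1) 1, slope f Q ω m l₁ t))
  dsimp only at hls
  have hl0 : l ≠ 0 := by
    rintro rfl
    rw [hzero] at hls
    exact hs.ne hls
  have hBl : BFun f Q ω m l = ENNReal.ofReal s := by
    rw [BFun_eq_ofReal_integral hm.2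
      (slope_integrable_of_lt h hm hl.1 (hl.2.trans_lt h1)), hls]
  exact ⟨l, ⟨lt_of_le_of_ne hl.1 hl0.symm, hl.2.trans h1.le⟩, hBl.le, Or.inl hBl⟩

end Multiplier

/-! ### Properties of the candidate -/

section Candidate

variable {p : ℝ → ℝ} {m s J t : ℝ} (hm : m < 1) (hp : IntegrableOn p (Ioo (2 * m - 1) 1))

include hm hp

lemma jumpPrimitive_strictMonoOn (hp0 : ∀ t, 0 ≤ p t)
    (hpp : ∀ᵐ t ∂volume.restrict (Ioo (2 * m - 1) 1), 0 < p t) (hJ : 0 ≤ J) :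
    StrictMonoOn (jumpPrimitive p m s J) (Icc (2 * m - 1) 1) := by
  intro x hx y hy hxy
  have hmI := mem_Icc_of_lt_one hm
  have hsub : Ioo x y ⊆ Ioo (2 * m - 1) 1 := Ioo_subset_Ioo hx.1 hy.2
  have hpos : 0 < ∫ t in x..y, p t := by
    rw [intervalIntegral_eq_setIntegral_Ioo hxy.le]
    refine lt_of_le_of_ne (integral_nonneg hp0) fun h0 => ?_
    have h1 := (integral_eq_zero_iff_of_nonneg hp0 (hp.mono_set hsub)).1 h0.symm
    have h2 : ∀ᵐ t ∂volume.restrict (Ioo x y), False := by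
      filter_upwards [h1, ae_mono (Measure.restrict_mono hsub le_rfl) hpp] with t ht ht'
      exact ht'.ne' ht
    rw [eventually_false_iff_eq_bot, ae_eq_bot, Measure.restrict_eq_zero, Real.volume_Ioo,
      ENNReal.ofReal_eq_zero] at h2
    linarith
  have hsign : (SignType.sign (x - m) : ℝ) ≤ SignType.sign (y - m) :=
    monotone_coe_sign_sub m hxy.le
  have hadd := intervalIntegral.integral_add_adjacent_intervals
    (intervalIntegrable_of_integrableOn_Ioo hp hmI hx)
    (intervalIntegrable_of_integrableOn_Ioo hp hx hy)
  have := mul_le_mul_of_nonneg_left hsign (show 0 ≤ J / 2 by linarith)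
  simp only [jumpPrimitive]
  linarith

lemma jumpPrimitive_continuousWithinAt (ht : t ∈ Icc (2 * m - 1) 1) (htm : t ≠ m) :
    ContinuousWithinAt (jumpPrimitive p m s J) (Icc (2 * m - 1) 1) t := by
  have h1 := continuousOn_primitive hp (mem_Icc_of_lt_one hm) t ht
  have h2 : ContinuousAt (fun t => (SignType.sign (t - m) : ℝ)) t :=
    (continuous_of_discreteTopology (f := fun a : SignType => (a : ℝ))).continuousAt.comp
      (ContinuousAt.comp (f := fun t => t - m) (continuousAt_sign_of_ne_zero (sub_ne_zero.2 htm))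
        (by fun_prop))
  exact (continuousWithinAt_const.add h1).add (continuousWithinAt_const.mul h2.continuousWithinAt)

lemma jumpPrimitive_tendsto_nhdsGT :
    Tendsto (jumpPrimitive p m s J) (𝓝[>] m) (𝓝 (s / 2 + J / 2)) := by
  have hmI := mem_Icc_of_lt_one hm
  have h1 : Tendsto (fun t => ∫ x in m..t, p x) (𝓝[>] m) (𝓝 0) := by
    have := (continuousOn_primitive hp hmI m hmI).tendsto
    rw [intervalIntegral.integral_same] at this
    refine this.mono_left ?_
    rw [← nhdsWithin_Ioo_eq_nhdsGT hm]
    exact nhdsWithin_mono _ fun x hx => ⟨by linarith [hx.1], hx.2.le⟩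
  have h2 := h1.const_add (s / 2 + J / 2)
  rw [add_zero] at h2
  refine h2.congr' ?_
  filter_upwards [self_mem_nhdsWithin] with t ht
  rw [jumpPrimitive_of_lt ht]

end Candidate

/-! ### The energy of the candidate -/

section Energy

variable {f Q ω : ℝ → ℝ} {m l l' : ℝ} (h : Hypotheses f Q ω) (hm : m ∈ Ioo (0 : ℝ) 1)
  (hl : l ∈ Icc 0 √(kHat f Q ω m))

lemma two_mul_lintegral_energy (hm1 : m < 1) (l : ℝ) :
    2 * ∫⁻ t in Ioo m 1, ENNReal.ofReal √(kHat f Q ω t * |slope f Q ω m l t| ^ 2 + ω (1 - t)) =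
    ∫⁻ t in Ioo (2 * m - 1) 1, ENNReal.ofReal
      √(kEven f Q ω m t * |slope f Q ω m l t| ^ 2 + omegaEven ω m t) := by
  refine (lintegral_Ioo_eq_two_mul hm1 (fun t => ?_) fun t ht => ?_).symm
  · rw [slope_reflect, kEven_reflect, omegaEven_reflect]
  · rw [kEven_eq ht.1.le, omegaEven_eq ht.1.le]

include h hm

/-- The multiplier is determined by the slope. -/
lemma multiplier_unique (hl : l ∈ Icc 0 √(kHat f Q ω m)) (hl' : l' ∈ Icc 0 √(kHat f Q ω m))
    (hae : ∀ᵐ t ∂volume.restrict (Ioo (2 * m - 1) 1), slope f Q ω m l t = slope f Q ω m l' t) :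
    l' = l := by
  wlog hlt : l < l' generalizing l l' with H
  · rcases lt_trichotomy l l' with h1 | h1 | h1
    · exact absurd h1 hlt
    · exact h1.symm
    · exact (H hl' hl (hae.mono fun t ht => ht.symm) h1).symm
  have h2 : ∀ᵐ t ∂volume.restrict (Ioo (2 * m - 1) 1), False := by
    filter_upwards [hae, ae_restrict_mem_and_ne m] with t ht ⟨h1, h2⟩
    exact (slope_lt_slope h hm hl.1 hlt hl'.2 h1 h2).ne ht
  rw [eventually_false_iff_eq_bot, ae_eq_bot, Measure.restrict_eq_zero, Real.volume_Ioo,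
    ENNReal.ofReal_eq_zero] at h2
  linarith [hm.2]

include hl

/-- The affine bound is an equality at the slope, so the energy is λB + A. -/
lemma lintegral_energy_slope (hp : IntegrableOn (slope f Q ω m l) (Ioo (2 * m - 1) 1)) :
    ∫⁻ t in Ioo (2 * m - 1) 1, ENNReal.ofReal
      √(kEven f Q ω m t * |slope f Q ω m l t| ^ 2 + omegaEven ω m t) =
    ENNReal.ofReal (l * (∫ t in Ioo (2 * m - 1) 1, slope f Q ω m l t) +
      ∫ t in Ioo (2 * m - 1) 1, dualDensity f Q ω m l t) := by
  have hint : Integrable (fun t => l * slope f Q ω m l t + dualDensity f Q ω m l t)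
      (volume.restrict (Ioo (2 * m - 1) 1)) := (hp.const_mul l).add (dualDensity_integrable h hm l)
  rw [← integral_const_mul, ← integral_add (hp.const_mul l) (dualDensity_integrable h hm l),
    ofReal_integral_eq_lintegral_ofReal hint
      (ae_of_all _ fun t => add_nonneg (mul_nonneg hl.1 slope_nonneg) (Real.sqrt_nonneg _))]
  refine lintegral_congr_ae ?_
  filter_upwards [ae_restrict_mem_and_ne m] with t ⟨ht, htm⟩
  rw [slope, sqrt_at_slope_eq_affine (kEven_pos h hm ht) (omegaEven_pos h hm ht).le hl.1
    (sq_lt_kEven h hm hl ht htm)]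
  rfl

lemma two_mul_lintegral_energy_eq :
    2 * ∫⁻ t in Ioo m 1, ENNReal.ofReal √(kHat f Q ω t * ω (1 - t) / (kHat f Q ω t - l ^ 2)) =
    ∫⁻ t in Ioo (2 * m - 1) 1, ENNReal.ofReal
      √(kEven f Q ω m t * |slope f Q ω m l t| ^ 2 + omegaEven ω m t) := by
  rw [← two_mul_lintegral_energy hm.2]
  congr 1
  refine setLIntegral_congr_fun measurableSet_Ioo fun t ht => ?_
  have ht' : t ∈ Ioo (2 * m - 1) 1 := ⟨by linarith [ht.1, hm.2], ht.2⟩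
  have hK := kEven_pos h hm ht'
  have hW := omegaEven_pos h hm ht'
  have hlK := sq_lt_kEven h hm hl ht' ht.1.ne'
  have := sqrt_at_slope_eq hK hW.le hlK
  rw [← slope, kEven_eq ht.1.le, omegaEven_eq ht.1.le] at this
  simp only [this]

end Energy

end CohesivePhaseField

/-! ### Assembly of the theorem -/

open CohesivePhaseField in
theorem mainTheorem8 (f Q ω : ℝ → ℝ) (h : CohesivePhaseField.Hypotheses f Q ω)
    (m s : ℝ) (hm : m ∈ Ioo (0 : ℝ) 1) (hs : 0 < s) :
    ∃ w : CohesivePhaseField.L1 m,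
      -- `w` is the unique minimizer, with finite energy
      CohesivePhaseField.IsMinimizer f Q ω m s w ∧
      (∀ v : CohesivePhaseField.L1 m, CohesivePhaseField.IsMinimizer f Q ω m s v → v = w) ∧
      CohesivePhaseField.scG f Q ω m s w ≠ ⊤ ∧
      CohesivePhaseField.MemSBV (2 * m - 1) 1 w ∧
      -- `u` is the representative of `w`, `Dw = g 𝓛¹ + ν`, `l` is `λ_{m,s}`, `r` is `w(m⁺)`
      ∃ (u g : ℝ → ℝ) (ν : SignedMeasure ℝ) (l r : ℝ),
        -- strictly increasing, odd symmetric about `m`, and attaining the boundary data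
        u =ᵐ[volume.restrict (Ioo (2 * m - 1) 1)] w ∧
        StrictMonoOn u (Icc (2 * m - 1) 1) ∧
        (∀ t ∈ Icc (2 * m - 1) 1, u (2 * m - t) - s / 2 = -(u t - s / 2)) ∧
        u (2 * m - 1) = 0 ∧ u 1 = s ∧
        ContinuousWithinAt u (Icc (2 * m - 1) 1) (2 * m - 1) ∧
        ContinuousWithinAt u (Icc (2 * m - 1) 1) 1 ∧
        Tendsto u (𝓝[>] m) (𝓝 r) ∧
        -- the derivative, whose singular part is concentrated on `t = m`
        CohesivePhaseField.HasBVDeriv (2 * m - 1) 1 w g ν ∧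
        ν.totalVariation {m}ᶜ = 0 ∧
        -- the Euler–Lagrange formula, with a unique `λ`
        l ∈ Ioc 0 √(CohesivePhaseField.kHat f Q ω m) ∧
        (∀ᵐ t ∂volume.restrict (Ioo (2 * m - 1) 1), g t = CohesivePhaseField.slope f Q ω m l t) ∧
        (∀ l' ∈ Ioc 0 √(CohesivePhaseField.kHat f Q ω m),
          (∀ᵐ t ∂volume.restrict (Ioo (2 * m - 1) 1),
            g t = CohesivePhaseField.slope f Q ω m l' t) → l' = l) ∧
        -- the minimal value
        CohesivePhaseField.scG f Q ω m s w =
          2 * (∫⁻ t in Ioo m 1, ENNReal.ofReal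
            √(CohesivePhaseField.kHat f Q ω t * |g t| ^ 2 + ω (1 - t))) +
          ENNReal.ofReal (2 * √(CohesivePhaseField.kHat f Q ω m) * (r - s / 2)) ∧
        s / 2 ≤ r ∧
        -- the Sobolev case
        (CohesivePhaseField.MemW11 (2 * m - 1) 1 w ↔
          ENNReal.ofReal s = CohesivePhaseField.BFun f Q ω m l) ∧
        (CohesivePhaseField.MemW11 (2 * m - 1) 1 w →
          ContinuousOn u (Icc (2 * m - 1) 1) ∧ u m = s / 2 ∧
          CohesivePhaseField.scG f Q ω m s w =
            2 * (∫⁻ t in Ioo m 1, ENNReal.ofReal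
              √(CohesivePhaseField.kHat f Q ω t * ω (1 - t) /
                (CohesivePhaseField.kHat f Q ω t - l ^ 2))) ∧
          CohesivePhaseField.scG f Q ω m s w = CohesivePhaseField.scriptG f Q ω m l ∧
          CohesivePhaseField.scG f Q ω m s w =
            CohesivePhaseField.AFun f Q ω m l + ENNReal.ofReal (l * s)) ∧
        -- the case of a jump at `t = m`
        (¬ CohesivePhaseField.MemW11 (2 * m - 1) 1 w ↔
          CohesivePhaseField.BFun f Q ω m √(CohesivePhaseField.kHat f Q ω m) <
            ENNReal.ofReal s) ∧
        (¬ CohesivePhaseField.MemW11 (2 * m - 1) 1 w →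
          l = √(CohesivePhaseField.kHat f Q ω m) ∧
          r = s - (CohesivePhaseField.BFun f Q ω m
            √(CohesivePhaseField.kHat f Q ω m)).toReal / 2 ∧
          CohesivePhaseField.scG f Q ω m s w =
            2 * (∫⁻ t in Ioo m 1, ENNReal.ofReal
              √(CohesivePhaseField.kHat f Q ω t * ω (1 - t) /
                (CohesivePhaseField.kHat f Q ω t - CohesivePhaseField.kHat f Q ω m))) +
            ENNReal.ofReal √(CohesivePhaseField.kHat f Q ω m) * (ENNReal.ofReal s -
              CohesivePhaseField.BFun f Q ω m √(CohesivePhaseField.kHat f Q ω m)) ∧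
          CohesivePhaseField.scG f Q ω m s w =
            CohesivePhaseField.scriptG f Q ω m √(CohesivePhaseField.kHat f Q ω m) +
            ENNReal.ofReal √(CohesivePhaseField.kHat f Q ω m) * (ENNReal.ofReal s -
              CohesivePhaseField.BFun f Q ω m √(CohesivePhaseField.kHat f Q ω m)) ∧
          CohesivePhaseField.scG f Q ω m s w =
            CohesivePhaseField.AFun f Q ω m √(CohesivePhaseField.kHat f Q ω m) +
            ENNReal.ofReal (√(CohesivePhaseField.kHat f Q ω m) * s)) := by
  obtain ⟨l, hlI, hBle, hBor⟩ := exists_multiplier h hm hs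
  have hl : l ∈ Icc 0 √(kHat f Q ω m) := Ioc_subset_Icc_self hlI
  have hp := slope_integrable_of_BFun_ne_top h hm (hBle.trans_lt ENNReal.ofReal_lt_top).ne
  have hpe : ∀ t, slope f Q ω m l (2 * m - t) = slope f Q ω m l t := fun t => slope_reflect
  have hB := BFun_eq_ofReal_integral hm.2 hp
  have hA := AFun_eq_ofReal_integral h hm l
  have hE := lintegral_energy_slope h hm hl hp
  have hE1 := two_mul_lintegral_energy (f := f) (Q := Q) (ω := ω) hm.2 l
  have hE2 := two_mul_lintegral_energy_eq h hm hl
  have hb0 : 0 ≤ ∫ t in Ioo (2 * m - 1) 1, slope f Q ω m l t :=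
    integral_nonneg fun t => slope_nonneg
  have hA0 : 0 ≤ ∫ t in Ioo (2 * m - 1) 1, dualDensity f Q ω m l t :=
    integral_nonneg fun t => Real.sqrt_nonneg _
  have hlow := fun v : L1 m => ofReal_le_scG (s := s) h hm hl hp v
  have huniq := fun u hul hur w hw v hv =>
    eq_of_scG_le (u := u) h hm hl hp hs.le hul hur w hw v hv
  obtain ⟨b, hb⟩ : ∃ b, b = ∫ t in Ioo (2 * m - 1) 1, slope f Q ω m l t := ⟨_, rfl⟩
  obtain ⟨A, hAd⟩ : ∃ A, A = ∫ t in Ioo (2 * m - 1) 1, dualDensity f Q ω m l t := ⟨_, rfl⟩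
  rw [← hb] at hB hE hb0
  rw [← hAd] at hA hE hA0
  simp only [← hAd] at hlow huniq
  rw [hE] at hE1 hE2
  have hbs : b ≤ s := by
    rw [hB] at hBle
    exact (ENNReal.ofReal_le_ofReal_iff hs.le).1 hBle
  obtain ⟨J, hJd⟩ : ∃ J, J = s - b := ⟨_, rfl⟩
  have hJ0 : 0 ≤ J := by linarith
  have hJ : (∫ t in Ioo (2 * m - 1) 1, slope f Q ω m l t) + J = s := by linarith
  -- A jump is present only when B(m,λ) < s, which forces the extreme multiplier. The price √k̂(m)·J
  -- of the jump is therefore always λJ.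
  have hJl : J ≠ 0 → l = √(kHat f Q ω m) := fun hne => hBor.resolve_left fun he => hne <| by
    rw [hB, ENNReal.ofReal_eq_ofReal_iff hb0 hs.le] at he
    linarith
  have hΛJ : √(kHat f Q ω m) * J = l * J := by
    rcases eq_or_ne J 0 with hz | hz
    · rw [hz, mul_zero, mul_zero]
    · rw [← hJl hz]
  have hlb : 0 ≤ l * b + A := by have := mul_nonneg hl.1 hb0; linarith
  have hlJ : 0 ≤ l * J := mul_nonneg hl.1 hJ0
  obtain ⟨p, hpd⟩ : ∃ p, p = slope f Q ω m l := ⟨_, rfl⟩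
  rw [← hpd] at hp hpe hJ
  have hL : MemLp (jumpPrimitive p m s J) 1 (volume.restrict (Ioo (2 * m - 1) 1)) :=
    memLp_one_iff_integrable.2 (jumpPrimitive_integrable hm.2 hp)
  obtain ⟨w, hw⟩ : ∃ w : L1 m,
      jumpPrimitive p m s J =ᵐ[volume.restrict (Ioo (2 * m - 1) 1)] w :=
    ⟨hL.toLp _, hL.coeFn_toLp.symm⟩
  -- Upper and lower bounds meet, because λb + A + λ(s − b) = λs + A.
  have hscG : scG f Q ω m s w = ENNReal.ofReal (l * s + A) := by
    refine le_antisymm ((scG_jumpPrimitive_le h hm hJ0 hpe hp hJ hw).trans (le_of_eq ?_)) (hlow w)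
    rw [hpd, hE, hΛJ, ← ENNReal.ofReal_add hlb hlJ, hJd]
    ring_nf
  have hmin : IsMinimizer f Q ω m s w :=
    le_antisymm (le_iInf fun v => hscG.le.trans (hlow v)) (iInf_le _ w)
  have hBV := jumpPrimitive_hasBVDeriv hm.2 hp hJ0 hw
  have hconc : (diracJordan m J.toNNReal).toSignedMeasure.totalVariation {m}ᶜ = 0 := by
    rw [diracJordan_totalVariation]
    simp
  have hW11 := memW11_jumpPrimitive_iff hm.2 hp hw
  have hppos : ∀ᵐ t ∂volume.restrict (Ioo (2 * m - 1) 1), 0 < p t := by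
    filter_upwards [ae_restrict_mem_and_ne m] with t ⟨ht, htm⟩
    rw [hpd]
    exact slope_pos h hm hlI ht htm
  have h1m : 2 * m - 1 < m := by linarith [hm.2]
  refine ⟨w, hmin, fun v hv => ?_, by rw [hscG]; exact ENNReal.ofReal_ne_top,
    ⟨p, _, hBV, {m}, countable_singleton m, hconc⟩,
    jumpPrimitive p m s J, p, _, l, s / 2 + J / 2, hw,
    jumpPrimitive_strictMonoOn hm.2 hp (fun t => by rw [hpd]; exact slope_nonneg) hppos hJ0,
    fun t _ => jumpPrimitive_reflect hpe,
    jumpPrimitive_left hm.2 hpe hp hJ, jumpPrimitive_one hm.2 hpe hp hJ,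
    jumpPrimitive_continuousWithinAt hm.2 hp (left_mem_Icc.2 (by linarith [hm.2])) h1m.ne,
    jumpPrimitive_continuousWithinAt hm.2 hp (right_mem_Icc.2 (by linarith [hm.2])) hm.2.ne',
    jumpPrimitive_tendsto_nhdsGT hm.2 hp, hBV, hconc, hlI, by simp [hpd],
    fun l' hl' hae => multiplier_unique h hm hl (Ioc_subset_Icc_self hl') (by simpa [hpd] using hae),
    ?_, by linarith, ?_, fun hW => ?_, ?_, fun hW => ?_⟩
  · rw [hpd] at hw hJ hp hpe
    refine huniq _ (fun t ht => jumpPrimitive_eq_of_gt hm.2 hpe hp hJ ht)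
      (fun t ht => jumpPrimitive_eq_of_lt hm.2 hpe hp hJ ht) w hw v ?_
    rw [← hscG, hmin]
    exact hv.le
  · rw [hscG, hpd, hE1, show 2 * √(kHat f Q ω m) * (s / 2 + J / 2 - s / 2) = √(kHat f Q ω m) * J by
      ring, hΛJ, ← ENNReal.ofReal_add hlb hlJ, hJd]
    ring_nf
  · rw [hW11, hB, ENNReal.ofReal_eq_ofReal_iff hs.le hb0, hJd, sub_eq_zero]
  · rw [hW11] at hW
    have hbs' : b = s := by linarith
    have hsum : ENNReal.ofReal (l * b + A) = AFun f Q ω m l + ENNReal.ofReal (l * s) := by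
      rw [hA, ← ENNReal.ofReal_add hA0 (mul_nonneg hl.1 hs.le), hbs', add_comm]
    refine ⟨fun t ht => ?_, jumpPrimitive_self, ?_, ?_, ?_⟩
    · rw [hW, jumpPrimitive_zero_eq]
      exact (continuousOn_const.add (continuousOn_primitive hp (mem_Icc_of_lt_one hm.2))) t ht
    · rw [hscG, hE2, hbs']
    · rw [hscG, scriptG, hB, ← ENNReal.ofReal_mul hl.1, hbs', ← hsum, hbs']
    · rw [hscG, ← hsum, hbs']
  · rw [hW11]
    constructor
    · intro hne
      rw [← hJl hne, hB, ENNReal.ofReal_lt_ofReal_iff hs]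
      exact lt_of_le_of_ne hbs fun he => hne (by linarith)
    -- Monotonicity of B gives B(m,λ) ≤ B(m,√k̂(m)) < s, which contradicts b = s.
    · intro hlt hz
      have := (BFun_mono h hm hl.1 hl.2 le_rfl).trans_lt hlt
      rw [hB, ENNReal.ofReal_lt_ofReal_iff hs] at this
      linarith
  · rw [hW11] at hW
    have hlΛ := hJl hW
    have hk : kHat f Q ω m = l ^ 2 := by rw [hlΛ, Real.sq_sqrt (h.kHat_pos hm).le]
    -- The truncated subtraction in `ℝ≥0∞` is the true difference here, since b ≤ s.
    have hdiff : ENNReal.ofReal s - BFun f Q ω m l = ENNReal.ofReal J := by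
      rw [hB, ← ENNReal.ofReal_sub _ hb0, hJd]
    have hsplit : ENNReal.ofReal (l * s + A) =
        ENNReal.ofReal (l * b + A) + ENNReal.ofReal l * ENNReal.ofReal J := by
      rw [← ENNReal.ofReal_mul hl.1, ← ENNReal.ofReal_add hlb hlJ, hJd]
      ring_nf
    refine ⟨hlΛ, ?_, ?_, ?_, ?_⟩
    · rw [← hlΛ, hB, ENNReal.toReal_ofReal hb0]
      linarith
    · rw [← hlΛ, hdiff, hk, hE2, hscG, hsplit]
    · rw [← hlΛ, hdiff, hscG, hsplit, scriptG, hA, hB, ← ENNReal.ofReal_mul hl.1 (q := b),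
        ← ENNReal.ofReal_add hA0 (mul_nonneg hl.1 hb0), add_comm (l * b)]
    · rw [← hlΛ, hscG, hA, ← ENNReal.ofReal_add hA0 (mul_nonneg hl.1 hs.le), add_comm]
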